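/- Let $1\le k\le n$ be integers and let $m>0$ and $K$ be real numbers. There is a constant $C>0$, depending only on $n,k,m,K$, such that the following holds. Let $p>1$ and $\varepsilon>0$, let $\varphi$ be a positive smooth function on the unit sphere $\mathbb S^n\subset\mathbb R^{n+1}$ with $\min_{\mathbb S^n}\varphi\ge m$ and $\|\varphi\|_{C^1}=\sup_{\mathbb S^n}|\varphi|+\sup_{\mathbb S^n}|\nabla\varphi|\le K$, and let $u\in C^2(\mathbb S^n)$ be a positive admissible solution of $$\sigma_k(\nabla^2u+uI)=u^{p-1+\varepsilon}\,(u^2+|\nabla u|^2)^{\frac{k+1-p}{2}}\,\varphi(x)\quad\text{on }\mathbb S^n .$$ Then $$\frac{|\nabla u(x)|}{u(x)}\le C\quad\text{for all }x\in\mathbb S^n,\qquad\text{and}\qquad \frac{\max_{\mathbb S^n}u}{\min_{\mathbb S^n}u}\le C .$$ Here $\nabla$ and $\nabla^2$ are the gradient and the covariant Hessian for the round metric, $\sigma_k$ of a symmetric matrix is the $k$-th elementary symmetric polynomial of its eigenvalues, and $u$ is admissible if $\sigma_i(\nabla^2u+uI)>0$ on $\mathbb S^n$ for all $1\le i\le k$.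 (In particular $C$ is independent of $\varepsilon$.) -/

import Mathlib

open scoped Manifold ContDiff

noncomputable section

/-- The unit sphere `𝕊ⁿ` in `ℝⁿ⁺¹`, with Mathlib's smooth structure. -/
abbrev Sph (n : ℕ) : Type := Metric.sphere (0 : EuclideanSpace ℝ (Fin (n + 1))) 1

namespace Sph

/-- The tangent space `T_x 𝕊ⁿ = x^⊥`, with the inner product of `ℝⁿ⁺¹` (the round metric). -/
abbrev tangent {n : ℕ} (x : Sph n) : Submodule ℝ (EuclideanSpace ℝ (Fin (n + 1))) :=
  (Submodule.span ℝ {(x : EuclideanSpace ℝ (Fin (n + 1)))})ᗮ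

/-- The radially constant extension `y ↦ u (y / |y|)` of a function on the sphere to
`ℝⁿ⁺¹ ∖ {0}` (with value `0` at the origin). -/
def ext {n : ℕ} (u : Sph n → ℝ) (y : EuclideanSpace ℝ (Fin (n + 1))) : ℝ :=
  if h : y ≠ 0 then
    u ⟨‖y‖⁻¹ • y, by
      rw [mem_sphere_zero_iff_norm, norm_smul, norm_inv, norm_norm,
        inv_mul_cancel₀ (norm_ne_zero_iff.mpr h)]⟩
  else 0

/-- The gradient `∇u(x)` for the round metric. As the extension is radially constant, its
Euclidean gradient at a point of the sphere is tangent to the sphere and is the Riemannian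
gradient of `u`. -/
def grad {n : ℕ} (u : Sph n → ℝ) (x : Sph n) : EuclideanSpace ℝ (Fin (n + 1)) :=
  gradient (ext u) (x : EuclideanSpace ℝ (Fin (n + 1)))

/-- The covariant Hessian `∇²u(X, Y)` of the round metric, for `X, Y ∈ T_x 𝕊ⁿ`. It equals the
Euclidean Hessian of any `C²` extension `U` of `u`, restricted to `T_x 𝕊ⁿ`, minus
`⟨X, Y⟩ ∂U/∂ν` with `ν = x` the outer normal; for the radially constant extension the last term
vanishes. -/
def hess {n : ℕ} (u : Sph n → ℝ) (x : Sph n) (X Y : tangent x) : ℝ :=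
  fderiv ℝ (fderiv ℝ (ext u)) (x : EuclideanSpace ℝ (Fin (n + 1)))
    (X : EuclideanSpace ℝ (Fin (n + 1))) (Y : EuclideanSpace ℝ (Fin (n + 1)))

/-- The matrix `b_{ij} = u_{ij} + u δ_{ij}` at `x` in the orthonormal frame `e` of `T_x 𝕊ⁿ`. -/
def bMatrix {n : ℕ} (u : Sph n → ℝ) (x : Sph n) (e : OrthonormalBasis (Fin n) ℝ (tangent x)) :
    Matrix (Fin n) (Fin n) ℝ :=
  Matrix.of fun i j => hess u x (e i) (e j) + u x * (if i = j then 1 else 0)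

/-- `σ_k(W)` for a symmetric matrix `W`: the `k`-th elementary symmetric polynomial of the
eigenvalues of `W`, counted with multiplicity. -/
def sigma {n : ℕ} (k : ℕ) (W : Matrix (Fin n) (Fin n) ℝ) : ℝ :=
  W.charpoly.roots.esymm k

/-- `W ∈ Γ_k` for a symmetric matrix `W`: `σ_i(W) > 0` for all `1 ≤ i ≤ k`. -/
def InGamma {n : ℕ} (k : ℕ) (W : Matrix (Fin n) (Fin n) ℝ) : Prop :=
  ∀ i : ℕ, 1 ≤ i → i ≤ k → 0 < sigma i W

/-- `u` is admissible: `(u_{ij} + u δ_{ij}) ∈ Γ_k` everywhere on the sphere. The eigenvalues do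
not depend on the orthonormal frame, so "for every frame" and "for some frame" agree. -/
def IsAdmissible {n : ℕ} (k : ℕ) (u : Sph n → ℝ) : Prop :=
  ∀ (x : Sph n) (e : OrthonormalBasis (Fin n) ℝ (tangent x)), InGamma k (bMatrix u x e)

/-- `u` solves `σ_k(u_{ij} + u δ_{ij}) = u^{p-1+ε} (u² + |∇u|²)^{(k+1-p)/2} φ` on the sphere. -/
def IsSolution {n : ℕ} (k : ℕ) (p ε : ℝ) (φ u : Sph n → ℝ) : Prop :=
  ∀ (x : Sph n) (e : OrthonormalBasis (Fin n) ℝ (tangent x)),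
    sigma k (bMatrix u x e) =
      u x ^ (p - 1 + ε) * (u x ^ 2 + ‖grad u x‖ ^ 2) ^ (((k : ℝ) + 1 - p) / 2) * φ x

/-- The norm `‖φ‖_{C¹} = sup |φ| + sup |∇φ|` of a `C¹` function on the sphere. -/
def normC1 {n : ℕ} (φ : Sph n → ℝ) : ℝ :=
  (⨆ x, |φ x|) + ⨆ x, ‖grad φ x‖

end Sph

end

/-! Let f = log u, extended to be constant along rays. The matrix W = (f_ij + f_i f_j + δ_ij) equals
u⁻¹(u_ij + u δ_ij), and homogeneity of σ_k turns the equation into σ_k(W) = e^{εf} (1+|∇f|²)^q φ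
with q = (k+1-p)/2 < k/2. It suffices to bound L = max |∇f|, since this also bounds the oscillation
of f. At a maximum of f one has W ≤ I, so e^{εf} ≤ σ_k(I)/m everywhere (`exp_le`), and the right
side is at most C₀ R^k with R = √(1+|∇f|²).

For smoother u one would differentiate the equation at a maximum of |∇f|. Since u is only C², the
variables are doubled instead: f(x) - f(y) + κ⟨x,y⟩ is maximized over pairs of unit vectors. As κ →
∞ the maximizers satisfy |x-y| → 0 and κ|x-y| → L (`exists_doubled_max_sequence`), and along a
subsequence they converge to a point where |∇f| = L. The first variation gives |∇f(x)| = |∇f(y)|.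
The second variation, in frames matched by the rotation taking y to x, gives W(y) ≥ W(x) + κ|x-y|²
P, where P projects orthogonally to the gradient direction (`posSemidef_of_isDoubledMax`). Since
f(y) ≤ f(x) and ε > 0, the exponential has the favourable sign and only the variation of φ is left
(`rhs_sub_le`); this is why the bound does not depend on ε. Monotonicity of σ_k on Γ_k and division
by |x-y| yield L·D ≤ (K/m) σ_k(W) at the limit point, where D is the derivative of σ_k at W in the
direction P.

At the limit W splits as R² plus a block with eigenvalues s. For k ≥ 2, D ≥ R² σ_{k-2}(s); combined
with the Newton and Maclaurin inequalities for s and with σ_k(W) ≤ C₀ R^k, this bounds R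
(`bound_of_esymm_relations`). For k = 1, D carries no factor R², so x and y are moved at different
speeds (`snd_variation_scaled`). This brings in the trace of the block, σ_1(W) - R², and a term of
order R² is then dominated by terms linear in R (`le_of_eq_one`). -/

noncomputable section

/-! ### Newton and Maclaurin inequalities for elementary symmetric functions. -/

namespace Multiset

theorem esymm_cons_succ {R : Type*} [CommSemiring R] (a : R) (s : Multiset R) (k : ℕ) :
    (a ::ₘ s).esymm (k + 1) = a * s.esymm k + s.esymm (k + 1) := by
  simp only [Multiset.esymm, Multiset.powersetCard_cons, Multiset.map_add, Multiset.sum_add,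
    Multiset.map_map, Function.comp_def, Multiset.prod_cons, Multiset.sum_map_mul_left]
  rw [add_comm]

theorem esymm_zero_eq_one {R : Type*} [CommSemiring R] (s : Multiset R) : s.esymm 0 = 1 := by
  simp [Multiset.esymm]

theorem esymm_eq_zero_of_card_lt {R : Type*} [CommSemiring R] (s : Multiset R) {k : ℕ}
    (h : s.card < k) : s.esymm k = 0 := by
  simp [Multiset.esymm, Multiset.powersetCard_eq_empty k h]

end Multiset

namespace Polynomial

/-- Laguerre's inequality for a product of real linear factors. -/
theorem laguerre_of_multiset (s : Multiset ℝ) (x : ℝ) :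
    (s.map fun r => X - C r).prod.eval x *
        (derivative (derivative (s.map fun r => X - C r).prod)).eval x ≤
      ((derivative (s.map fun r => X - C r).prod).eval x) ^ 2 := by
  induction s using Multiset.induction_on with
  | empty => simp
  | cons a s ih =>
    simp only [Multiset.map_cons, Multiset.prod_cons, derivative_mul, derivative_add,
      derivative_sub, derivative_X, derivative_C, sub_zero, one_mul, eval_add, eval_mul, eval_sub,
      eval_X, eval_C]
    -- For q = (X - a)p one has q'² - q q'' = p² + (x-a)²(p'² - p p'').
    nlinarith [mul_nonneg (sq_nonneg (x - a)) (sub_nonneg.2 ih),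
      sq_nonneg ((s.map fun r => X - C r).prod.eval x)]

/-- Laguerre's inequality for real-rooted polynomials. -/
theorem Splits.laguerre {p : ℝ[X]} (hp : p.Splits) (x : ℝ) :
    p.eval x * (derivative (derivative p)).eval x ≤ ((derivative p).eval x) ^ 2 := by
  have h := hp.eq_prod_roots
  have h2 := laguerre_of_multiset p.roots x
  set q := (p.roots.map fun r => X - C r).prod
  rw [h]
  simp only [derivative_C_mul, eval_mul, eval_C]
  nlinarith [mul_le_mul_of_nonneg_left h2 (sq_nonneg p.leadingCoeff)]

/-- Rolle's theorem, counted with multiplicity: differentiation loses at most one real root, and it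
lowers the degree by one. -/
theorem Splits.derivative_of_real {p : ℝ[X]} (hp : p.Splits) : (derivative p).Splits := by
  rw [splits_iff_card_roots] at hp ⊢
  have h1 := card_roots_le_derivative p
  have h2 := natDegree_derivative_le p
  have h3 := card_roots' (derivative p)
  rcases Nat.eq_zero_or_pos p.natDegree with h | h
  · have : derivative p = 0 := by
      rw [eq_C_of_natDegree_eq_zero h]; simp
    simp [this]
  · omega

theorem Splits.iterate_derivative_of_real {p : ℝ[X]} (hp : p.Splits) (i : ℕ) :
    (derivative^[i] p).Splits := by
  induction i with
  | zero => simpa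
  | succ i ih => rw [Function.iterate_succ_apply']; exact ih.derivative_of_real

/-- A weak form of Newton's inequality for the coefficients of a real-rooted polynomial. -/
theorem Splits.coeff_mul_coeff_le {p : ℝ[X]} (hp : p.Splits) (i : ℕ) :
    p.coeff i * p.coeff (i + 2) ≤ p.coeff (i + 1) ^ 2 := by
  -- The i-th derivative is again real-rooted, and its value and first two derivatives at 0 are the
  -- coefficients i, i+1, i+2 up to factorials.
  have h := (hp.iterate_derivative_of_real i).laguerre 0
  simp only [← Function.iterate_succ_apply' derivative, ← coeff_zero_eq_eval_zero,
    coeff_iterate_derivative, zero_add, Nat.descFactorial_self, nsmul_eq_mul] at h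
  have e1 : ((i + 1).factorial : ℝ) = (i + 1) * i.factorial := by
    rw [Nat.factorial_succ]; push_cast; ring
  have e2 : ((i + 2).factorial : ℝ) = (i + 2) * ((i + 1) * i.factorial) := by
    rw [Nat.factorial_succ, Nat.factorial_succ]; push_cast; ring
  rw [show i.succ.succ = i + 2 from rfl, show i.succ = i + 1 from rfl, e1, e2] at h
  have hf : (0 : ℝ) < i.factorial := by positivity
  set F : ℝ := ((i.factorial : ℕ) : ℝ)
  set A := p.coeff i
  set B := p.coeff (i + 1)
  set D := p.coeff (i + 2)
  -- The true Newton constant is (i+2)/(i+1) > 1; it may be dropped only where the product is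
  -- positive.
  rcases le_or_gt (A * D) 0 with h0 | h0
  · exact h0.trans (sq_nonneg _)
  · have h' : F ^ 2 * (i + 1) * ((i + 2) * (A * D)) ≤ F ^ 2 * (i + 1) * ((i + 1) * B ^ 2) := by
      nlinarith
    have h'' := le_of_mul_le_mul_left h' (by positivity)
    have : (i + 1 : ℝ) * (A * D) ≤ (i + 1) * B ^ 2 := by nlinarith
    exact le_of_mul_le_mul_left this (by positivity)

end Polynomial

namespace Multiset

/-- A weak form of Newton's inequality. -/
theorem esymm_mul_esymm_le (s : Multiset ℝ) (j : ℕ) :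
    s.esymm j * s.esymm (j + 2) ≤ s.esymm (j + 1) ^ 2 := by
  rcases lt_or_ge s.card (j + 2) with h | h
  · rw [esymm_eq_zero_of_card_lt s h, mul_zero]; positivity
  · have hs : (s.map fun r => Polynomial.X + Polynomial.C r).prod.Splits := by
      have : (s.map fun r => Polynomial.X + Polynomial.C r) =
          ((s.map fun r => -r).map fun r => Polynomial.X - Polynomial.C r) := by
        simp [Multiset.map_map]
      rw [this]
      exact Polynomial.Splits.multisetProd (by simp +contextual)
    obtain ⟨i, hi⟩ : ∃ i, s.card = i + (j + 2) := ⟨s.card - (j + 2), by omega⟩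
    have := hs.coeff_mul_coeff_le i
    rw [Multiset.prod_X_add_C_coeff _ (by omega), Multiset.prod_X_add_C_coeff _ (by omega),
      Multiset.prod_X_add_C_coeff _ (by omega)] at this
    rw [show s.card - i = j + 2 by omega, show s.card - (i + 1) = j + 1 by omega,
      show s.card - (i + 2) = j by omega] at this
    linarith

/-- If the first `k` elementary symmetric functions of `a, s` are positive, then so are the first
`k - 1` elementary symmetric functions of `s`. -/
theorem esymm_pos_of_cons (a : ℝ) (s : Multiset ℝ) (k : ℕ)
    (h : ∀ i, i ≤ k → 0 < (a ::ₘ s).esymm i) : ∀ i, i + 1 ≤ k → 0 < s.esymm i := by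
  intro i
  induction i with
  | zero => intro _; simp [esymm_zero_eq_one]
  | succ i ih =>
    intro hi
    have h0 := ih (by omega)
    have h1 := h (i + 1) (by omega)
    have h2 := h (i + 2) (by omega)
    rw [esymm_cons_succ] at h1 h2
    have hN := esymm_mul_esymm_le s i
    by_contra! hneg
    set A := s.esymm i
    set B := s.esymm (i + 1)
    set D := s.esymm (i + 2)
    -- If B ≤ 0, positivity for the full multiset forces a > 0, aA > -B and D > a(-B), whence AD >
    -- B², against Newton.
    have h3 : 0 < a * A := by linarith
    have ha : 0 < a := pos_of_mul_pos_left h3 h0.le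
    have hD : a * (-B) < D := by linarith
    have : 0 < D := lt_of_le_of_lt (mul_nonneg ha.le (by linarith)) hD
    nlinarith [mul_pos h0 this, mul_lt_mul_of_pos_left hD h0,
      mul_le_mul_of_nonneg_right h1.le (neg_nonneg.2 hneg)]

/-- Maclaurin's inequality (without constants) for consecutive elementary symmetric functions. -/
theorem esymm_pow_le (s : Multiset ℝ) (k : ℕ) (h : ∀ i, i ≤ k + 1 → 0 < s.esymm i) :
    s.esymm (k + 1) ^ k ≤ s.esymm k ^ (k + 1) := by
  induction k with
  | zero => simp [esymm_zero_eq_one]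
  | succ k ih =>
    have ih := ih fun i hi => h i (by omega)
    have h0 := h k (by omega)
    have h1 := h (k + 1) (by omega)
    have h2 := h (k + 2) (by omega)
    have hN := esymm_mul_esymm_le s k
    set A := s.esymm k
    set B := s.esymm (k + 1)
    set D := s.esymm (k + 2)
    have h4 : (A * D) ^ (k + 1) ≤ (B ^ 2) ^ (k + 1) :=
      pow_le_pow_left₀ (by positivity) hN _
    have h5 : B ^ k * D ^ (k + 1) ≤ B ^ k * B ^ (k + 2) := by
      -- The induction hypothesis B^k ≤ A^(k+1) is multiplied into the (k+1)-st power of Newton's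
      -- inequality, and B^k is then cancelled.
      calc B ^ k * D ^ (k + 1) ≤ A ^ (k + 1) * D ^ (k + 1) := by gcongr
        _ = (A * D) ^ (k + 1) := by ring
        _ ≤ _ := h4
        _ = _ := by ring
    exact le_of_mul_le_mul_left h5 (by positivity)

end Multiset

/-! ### Rank-one perturbations and monotonicity of σ_k on Γ_k. -/

namespace Matrix

open Polynomial

variable {n : ℕ}

theorem det_diagonal_add_vecMulVec {R : Type*} [Field R] {m : Type*} [Fintype m] [DecidableEq m]
    (d u v : m → R) (hd : ∀ i, d i ≠ 0) :
    (diagonal d + vecMulVec u v).det =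
      ∏ i, d i + ∑ i, u i * v i * ∏ j ∈ Finset.univ.erase i, d j := by
  have hu : IsUnit (diagonal d).det := by
    rw [det_diagonal, isUnit_iff_ne_zero]
    exact Finset.prod_ne_zero_iff.2 fun i _ => hd i
  rw [vecMulVec_eq Unit, det_add_replicateCol_mul_replicateRow hu, det_diagonal]
  have hinv : (diagonal d)⁻¹ = diagonal fun i => (d i)⁻¹ := by
    apply inv_eq_right_inv
    rw [diagonal_mul_diagonal, ← diagonal_one]
    congr 1
    ext i
    exact mul_inv_cancel₀ (hd i)
  rw [hinv, det_unique, add_apply, one_apply_eq, mul_add, mul_one]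
  congr 1
  rw [mul_apply, Finset.mul_sum]
  simp only [mul_diagonal, replicateRow_apply, replicateCol_apply]
  refine Finset.sum_congr rfl fun i _ => ?_
  rw [← Finset.mul_prod_erase _ _ (Finset.mem_univ i)]
  field_simp [hd i]

theorem charpoly_diagonal_add_vecMulVec {m : Type*} [Fintype m] [DecidableEq m] (d v : m → ℝ) :
    (diagonal d + vecMulVec v v).charpoly =
      ∏ i, (X - C (d i)) - ∑ i, C (v i ^ 2) * ∏ j ∈ Finset.univ.erase i, (X - C (d j)) := by
  refine Polynomial.eq_of_infinite_eval_eq _ _ ?_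
  -- Off the finitely many values of `d` the diagonal part is invertible and the matrix determinant
  -- lemma applies; agreement at infinitely many points is enough.
  refine Set.Infinite.mono (s := (Set.range d)ᶜ) ?_ (Set.finite_range d).infinite_compl
  intro x hx
  have h : scalar m x - (diagonal d + vecMulVec v v) =
      diagonal (fun i => x - d i) + vecMulVec (-v) v := by
    rw [scalar_apply, neg_vecMulVec, ← sub_eq_add_neg, ← sub_sub, diagonal_sub]
  have hd : ∀ i, x - d i ≠ 0 := fun i h0 => hx ⟨i, by linarith⟩
  simp only [Set.mem_ofPred_eq, eval_charpoly, h, det_diagonal_add_vecMulVec _ _ _ hd,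
    eval_sub, eval_prod, eval_X, eval_C, eval_finsetSum, eval_mul, Pi.neg_apply]
  rw [sub_eq_add_neg, ← Finset.sum_neg_distrib]
  congr 1
  refine Finset.sum_congr rfl fun i _ => by ring

end Matrix

namespace Sph

open Polynomial Matrix

variable {n : ℕ}

/-- The signed coefficient of the characteristic polynomial that equals `σ_k` for symmetric
matrices. -/
def sigmaCoeff (k : ℕ) (W : Matrix (Fin n) (Fin n) ℝ) : ℝ :=
  (-1) ^ k * W.charpoly.coeff (n - k)

theorem coeff_prod_X_sub_C (s : Multiset ℝ) (k : ℕ) (hk : k ≤ s.card) :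
    (-1) ^ k * (s.map fun r => X - C r).prod.coeff (s.card - k) = s.esymm k := by
  rw [Multiset.prod_X_sub_C_coeff _ (by omega), show s.card - (s.card - k) = k by omega,
    ← mul_assoc, ← mul_pow]
  simp

theorem sigma_eq_esymm (k : ℕ) {W : Matrix (Fin n) (Fin n) ℝ} {s : Multiset ℝ}
    (h : W.charpoly = (s.map fun r => X - C r).prod) : sigma k W = s.esymm k := by
  rw [sigma, h, roots_multiset_prod_X_sub_C]

theorem sigma_eq_sigmaCoeff {k : ℕ} (hk : k ≤ n) {W : Matrix (Fin n) (Fin n) ℝ}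
    (hW : W.IsHermitian) : sigma k W = sigmaCoeff k W := by
  have h := hW.splits_charpoly.eq_prod_roots_of_monic (charpoly_monic W)
  have hc : W.charpoly.roots.card = n := by
    rw [hW.roots_charpoly_eq_eigenvalues]; simp
  rw [sigma_eq_esymm k h, ← coeff_prod_X_sub_C _ k (by omega), hc, sigmaCoeff, ← h]

/-- Every real symmetric matrix is conjugate to a diagonal one by an orthogonal matrix. -/
theorem exists_diagonalization {W : Matrix (Fin n) (Fin n) ℝ} (hW : W.IsHermitian) :
    ∃ (O : Matrix (Fin n) (Fin n) ℝ) (d : Fin n → ℝ), O * Oᵀ = 1 ∧ W = O * diagonal d * Oᵀ := by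
  refine ⟨hW.eigenvectorUnitary, hW.eigenvalues, ?_, ?_⟩
  · have := Unitary.coe_mul_star_self hW.eigenvectorUnitary
    simpa [star_eq_conjTranspose] using this
  · conv_lhs => rw [hW.spectral_theorem]
    simp [Unitary.conjStarAlgAut_apply, star_eq_conjTranspose]

theorem charpoly_conj_orthogonal {O : Matrix (Fin n) (Fin n) ℝ} (hO : O * Oᵀ = 1)
    (M : Matrix (Fin n) (Fin n) ℝ) : (O * M * Oᵀ).charpoly = M.charpoly := by
  rw [charpoly_mul_comm, ← mul_assoc, mul_eq_one_comm.1 hO, one_mul]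

theorem sigma_conj_orthogonal {O : Matrix (Fin n) (Fin n) ℝ} (hO : O * Oᵀ = 1) (k : ℕ)
    (M : Matrix (Fin n) (Fin n) ℝ) : sigma k (O * M * Oᵀ) = sigma k M := by
  rw [sigma, sigma, charpoly_conj_orthogonal hO]

theorem sigma_diagonal (k : ℕ) (d : Fin n → ℝ) :
    sigma k (diagonal d) = (Finset.univ.val.map d).esymm k := by
  apply sigma_eq_esymm
  rw [charpoly_diagonal, Finset.prod_eq_multiset_prod, Multiset.map_map]
  rfl

theorem sigma_zero (W : Matrix (Fin n) (Fin n) ℝ) : sigma 0 W = 1 :=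
  Multiset.esymm_zero_eq_one _

theorem sigma_smul (k : ℕ) {W : Matrix (Fin n) (Fin n) ℝ} (hW : W.IsHermitian) (c : ℝ) :
    sigma k (c • W) = c ^ k * sigma k W := by
  obtain ⟨O, d, hO, rfl⟩ := exists_diagonalization hW
  have : c • (O * diagonal d * Oᵀ) = O * diagonal (c • d) * Oᵀ := by
    rw [diagonal_smul, mul_smul_comm, smul_mul_assoc]
  rw [this, sigma_conj_orthogonal hO, sigma_conj_orthogonal hO, sigma_diagonal, sigma_diagonal]
  have h2 : (Finset.univ.val.map (c • d)) = (Finset.univ.val.map d).map (c * ·) := by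
    rw [Multiset.map_map]; rfl
  rw [h2, Multiset.esymm, Multiset.esymm, Multiset.powersetCard_map, Multiset.map_map,
    ← Multiset.sum_map_mul_left]
  congr 1
  refine Multiset.map_congr rfl fun t ht => ?_
  have hc := (Multiset.mem_powersetCard.1 ht).2
  rw [Function.comp_apply, Multiset.prod_map_mul, Multiset.map_const', Multiset.prod_replicate, hc,
    Multiset.map_id']

theorem sigma_diagonal_add_vecMulVec (k : ℕ) (hk : k + 1 ≤ n) (d v : Fin n → ℝ) :
    sigma (k + 1) (diagonal d + vecMulVec v v) = sigma (k + 1) (diagonal d) +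
      ∑ i, v i ^ 2 * ((Finset.univ.erase i).val.map d).esymm k := by
  have h1 : (diagonal d).IsHermitian := isHermitian_diagonal d
  have h2 : (diagonal d + vecMulVec v v).IsHermitian := by
    refine h1.add ?_
    ext i j; simp [vecMulVec_apply, mul_comm]
  rw [sigma_eq_sigmaCoeff hk h1, sigma_eq_sigmaCoeff hk h2, sigmaCoeff, sigmaCoeff,
    charpoly_diagonal_add_vecMulVec, charpoly_diagonal, coeff_sub, mul_sub, sub_eq_add_neg]
  congr 1
  rw [finsetSum_coeff, Finset.mul_sum, ← Finset.sum_neg_distrib]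
  refine Finset.sum_congr rfl fun i _ => ?_
  have hcard : ((Finset.univ.erase i).val.map d).card = n - 1 := by
    simp
  rw [coeff_C_mul, ← coeff_prod_X_sub_C _ k (by omega), hcard, Multiset.map_map,
    Finset.prod_eq_multiset_prod, show n - (k + 1) = n - 1 - k by omega, pow_succ]
  simp only [Function.comp_def]
  ring

/-- After diagonalization, the increment of σ_i is a combination with weights v_l² of σ_{i-1} of the
eigenvalues other than the l-th. These are positive on Γ_k by `esymm_pos_of_cons`. -/
theorem InGamma.add_vecMulVec {k : ℕ} (hkn : k ≤ n) {W : Matrix (Fin n) (Fin n) ℝ}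
    (hW : W.IsHermitian) (hG : InGamma k W) (v : Fin n → ℝ) :
    ∀ i, 1 ≤ i → i ≤ k → sigma i W ≤ sigma i (W + vecMulVec v v) := by
  obtain ⟨O, d, hO, rfl⟩ := exists_diagonalization hW
  intro i hi hik
  obtain ⟨i, rfl⟩ : ∃ j, i = j + 1 := ⟨i - 1, by omega⟩
  have hv : O *ᵥ (Oᵀ *ᵥ v) = v := by rw [mulVec_mulVec, hO, one_mulVec]
  have h : O * diagonal d * Oᵀ + vecMulVec v v =
      O * (diagonal d + vecMulVec (Oᵀ *ᵥ v) (Oᵀ *ᵥ v)) * Oᵀ := by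
    rw [mul_add, add_mul, mul_vecMulVec, vecMulVec_mul, hv, vecMul_transpose, hv]
  rw [h, sigma_conj_orthogonal hO, sigma_conj_orthogonal hO,
    sigma_diagonal_add_vecMulVec i (by omega)]
  refine le_add_of_nonneg_right (Finset.sum_nonneg fun l _ => mul_nonneg (sq_nonneg _) ?_)
  refine (Multiset.esymm_pos_of_cons (d l) _ k ?_ i hik).le
  intro j hj
  have h3 : d l ::ₘ (Finset.univ.erase l).val.map d = Finset.univ.val.map d := by
    rw [← Multiset.map_cons, Finset.erase_val, Multiset.cons_erase (Finset.mem_univ_val l)]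
  rw [h3, ← sigma_diagonal]
  rcases Nat.eq_zero_or_pos j with rfl | hj0
  · rw [sigma_zero]; exact one_pos
  · have := hG j hj0 hj
    rwa [sigma_conj_orthogonal hO] at this

/-- `σ_k` is monotone on `Γ_k`, and `Γ_k` is stable under adding nonnegative matrices. -/
theorem InGamma.add_posSemidef {k : ℕ} (hkn : k ≤ n) {W N : Matrix (Fin n) (Fin n) ℝ}
    (hW : W.IsHermitian) (hG : InGamma k W) (hN : N.PosSemidef) :
    InGamma k (W + N) ∧ ∀ i, 1 ≤ i → i ≤ k → sigma i W ≤ sigma i (W + N) := by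
  obtain ⟨B, hB⟩ : ∃ B : Matrix (Fin n) (Fin n) ℝ, N = Bᴴ * B := by
    open scoped MatrixOrder in
    exact CStarAlgebra.nonneg_iff_eq_star_mul_self.1 hN.nonneg
  -- A Gram matrix is the sum of the rank-one squares of the rows of its factor, so the rank-one
  -- case can be iterated.
  have hsum : N = ∑ i ∈ Finset.univ, vecMulVec (B i) (B i) := by
    ext a b
    rw [hB, mul_apply, Matrix.sum_apply]
    simp [vecMulVec_apply]
  rw [hsum]
  have key : ∀ s : Finset (Fin n), (W + ∑ i ∈ s, vecMulVec (B i) (B i)).IsHermitian ∧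
      InGamma k (W + ∑ i ∈ s, vecMulVec (B i) (B i)) ∧
      ∀ i, 1 ≤ i → i ≤ k → sigma i W ≤ sigma i (W + ∑ i ∈ s, vecMulVec (B i) (B i)) := by
    intro s
    induction s using Finset.induction_on with
    | empty => simpa using ⟨hW, hG⟩
    | insert a s ha ih =>
      obtain ⟨h1, h2, h3⟩ := ih
      have e : W + ∑ i ∈ insert a s, vecMulVec (B i) (B i) =
          (W + ∑ i ∈ s, vecMulVec (B i) (B i)) + vecMulVec (B a) (B a) := by
        rw [Finset.sum_insert ha]; abel
      have h4 := h2.add_vecMulVec hkn h1 (B a)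
      rw [e]
      refine ⟨h1.add ?_, fun i hi hik => (h2 i hi hik).trans_le (h4 i hi hik),
        fun i hi hik => (h3 i hi hik).trans (h4 i hi hik)⟩
      ext i j; simp [vecMulVec_apply, mul_comm]
  exact (key Finset.univ).2

end Sph

/-! ### Differentiating σ_k along the tail projection, and the algebraic bound for R. -/

namespace Multiset

theorem hasDerivAt_esymm_map_add (s : Multiset ℝ) (j : ℕ) :
    HasDerivAt (fun t : ℝ => (s.map (· + t)).esymm (j + 1))
      (((s.card : ℝ) - j) * s.esymm j) 0 := by
  induction s using Multiset.induction_on generalizing j with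
  | empty =>
    have : (fun t : ℝ => ((0 : Multiset ℝ).map (· + t)).esymm (j + 1)) = fun _ => 0 := by
      ext t; exact esymm_eq_zero_of_card_lt _ (by simp)
    rw [this]
    refine (hasDerivAt_const (0 : ℝ) (0 : ℝ)).congr_deriv ?_
    rcases Nat.eq_zero_or_pos j with rfl | h
    · simp
    · rw [esymm_eq_zero_of_card_lt _ (by simpa using h), mul_zero]
  | cons x s ih =>
    simp only [Multiset.map_cons, esymm_cons_succ, card_cons, Nat.cast_add, Nat.cast_one]
    have h1 : HasDerivAt (fun t : ℝ => x + t) 1 0 := (hasDerivAt_id _).const_add x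
    rcases Nat.eq_zero_or_pos j with rfl | h
    · simp only [esymm_zero_eq_one]
      refine ((h1.mul_const 1).add (ih 0)).congr_deriv ?_
      simp [esymm_zero_eq_one]; ring
    · obtain ⟨i, rfl⟩ : ∃ i, j = i + 1 := ⟨j - 1, by omega⟩
      refine ((h1.mul (ih i)).add (ih (i + 1))).congr_deriv ?_
      rw [esymm_cons_succ]
      simp only [add_zero, Multiset.map_id']
      push_cast
      ring

end Multiset

namespace Sph

open Polynomial Matrix Filter Topology

variable {n : ℕ}

theorem charpoly_of_row_zero {W : Matrix (Fin (n + 1)) (Fin (n + 1)) ℝ} {a : ℝ}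
    (h : ∀ j, W 0 j = if j = 0 then a else 0) :
    W.charpoly = (X - C a) * (W.submatrix Fin.succ Fin.succ).charpoly := by
  have h0 : ∀ j : Fin (n + 1), j ≠ 0 → W.charmatrix 0 j = 0 := by
    intro j hj
    rw [charmatrix_apply_ne _ _ _ hj.symm, h, if_neg hj]; simp
  rw [charpoly, det_succ_row_zero, Finset.sum_eq_single 0]
  · rw [charmatrix_apply_eq, h, if_pos rfl, charpoly]
    simp only [Fin.val_zero, pow_zero, one_mul]
    congr 2
    ext i j : 2
    rw [submatrix_apply, Fin.succAbove_zero]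
    rcases eq_or_ne i j with rfl | hij
    · simp [charmatrix_apply_eq]
    · rw [charmatrix_apply_ne _ _ _ (by simpa using hij), charmatrix_apply_ne _ _ _ hij]
      rfl
  · intro j _ hj
    rw [h0 j hj]; simp
  · simp

/-- The projection orthogonal to the first coordinate vector. -/
def tailProj (n : ℕ) : Matrix (Fin (n + 1)) (Fin (n + 1)) ℝ :=
  diagonal fun i => if i = 0 then 0 else 1

theorem tailProj_posSemidef : (tailProj n).PosSemidef := by
  refine PosSemidef.diagonal fun i => ?_
  dsimp only [Pi.zero_apply]
  split_ifs <;> simp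

/-- The symmetric matrix is block diagonal, and adding a multiple of the tail projection shifts the
eigenvalues of the second block only. One multiset thus describes σ_k on the whole line. -/
theorem exists_multiset_of_row_zero {W : Matrix (Fin (n + 1)) (Fin (n + 1)) ℝ}
    (hW : W.IsHermitian) {a : ℝ} (h : ∀ j, W 0 j = if j = 0 then a else 0) :
    ∃ s : Multiset ℝ, s.card = n ∧
      ∀ (k : ℕ) (t : ℝ), sigma k (W + t • tailProj n) = (a ::ₘ s.map (· + t)).esymm k := by
  have hW' : (W.submatrix Fin.succ Fin.succ).IsHermitian := hW.submatrix _
  refine ⟨(W.submatrix Fin.succ Fin.succ).charpoly.roots, ?_, fun k t => ?_⟩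
  · rw [hW'.roots_charpoly_eq_eigenvalues]; simp
  · apply sigma_eq_esymm
    have hr : ∀ j, (W + t • tailProj n) 0 j = if j = 0 then a else 0 := by
      intro j
      rw [Matrix.add_apply, h j, Matrix.smul_apply, tailProj]
      rcases eq_or_ne j 0 with rfl | hj
      · simp
      · simp [hj.symm]
    have hs : (W + t • tailProj n).submatrix Fin.succ Fin.succ =
        W.submatrix Fin.succ Fin.succ - scalar (Fin n) (-t) := by
      ext i j
      simp only [submatrix_apply, Matrix.add_apply, Matrix.smul_apply, tailProj, Matrix.sub_apply, scalar_apply,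
        diagonal_apply, Fin.succ_inj, Fin.succ_ne_zero, if_false, smul_eq_mul]
      split_ifs <;> ring
    rw [charpoly_of_row_zero hr, hs, charpoly_sub_scalar]
    conv_lhs =>
      rw [hW'.splits_charpoly.eq_prod_roots_of_monic (charpoly_monic _)]
    rw [multiset_prod_comp, Multiset.map_cons, Multiset.prod_cons, Multiset.map_map,
      Multiset.map_map]
    congr 3
    ext r : 1
    simp only [Function.comp_apply, sub_comp, X_comp, C_comp, C_neg, C_add]
    ring

theorem contDiff_eval_mvPolynomial {ι : Type*} [Fintype ι] (p : MvPolynomial ι ℝ) :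
    ContDiff ℝ 1 fun x : ι → ℝ => MvPolynomial.eval x p := by
  induction p using MvPolynomial.induction_on with
  | C a => simpa using contDiff_const
  | add p q hp hq => simpa using hp.add hq
  | mul_X p i hp => simpa using hp.mul (contDiff_apply ℝ ℝ i)

/-- The root-based `sigma` is not visibly smooth, while a coefficient of the characteristic
polynomial is a polynomial in the entries. All differentiation of σ_k goes through this. -/
theorem contDiff_sigmaCoeff (k : ℕ) :
    ContDiff ℝ 1 fun w : Fin n → Fin n → ℝ => sigmaCoeff k (Matrix.of w) := by
  have h : ∀ w : Fin n → Fin n → ℝ, sigmaCoeff k (Matrix.of w) =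
      (-1) ^ k * MvPolynomial.eval (fun ij : Fin n × Fin n => w ij.1 ij.2)
        ((charpoly.univ ℝ (Fin n)).coeff (n - k)) := by
    intro w
    have := charpoly.univ_coeff_eval₂Hom (n := Fin n) (RingHom.id ℝ)
      (fun ij : Fin n × Fin n => w ij.1 ij.2) (n - k)
    rw [sigmaCoeff]
    congr 1
    exact this.symm
  simp only [h]
  refine contDiff_const.mul ((contDiff_eval_mvPolynomial _).comp ?_)
  fun_prop

/-- Difference quotients of `σ_k` along converging sequences converge to the derivative. -/
theorem tendsto_slope_sigmaCoeff {ι : Type*} {l : Filter ι} (k : ℕ)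
    {Z : ι → Matrix (Fin n) (Fin n) ℝ} {Z₀ P : Matrix (Fin n) (Fin n) ℝ} {τ : ι → ℝ} {D : ℝ}
    (hZ : Tendsto Z l (𝓝 Z₀)) (hτ : Tendsto τ l (𝓝 0)) (hτ0 : ∀ᶠ j in l, τ j ≠ 0)
    (hD : HasDerivAt (fun t : ℝ => sigmaCoeff k (Z₀ + t • P)) D 0) :
    Tendsto (fun j => (τ j)⁻¹ * (sigmaCoeff k (Z j + τ j • P) - sigmaCoeff k (Z j))) l (𝓝 D) := by
  let g : (Fin n → Fin n → ℝ) → ℝ := fun w => sigmaCoeff k (Matrix.of w)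
  let z₀ : Fin n → Fin n → ℝ := Z₀
  let p : Fin n → Fin n → ℝ := P
  let z : ι → Fin n → Fin n → ℝ := Z
  -- Both ends of the difference quotient move, so strict differentiability at the limit is
  -- required.
  have hg : HasStrictFDerivAt g (fderiv ℝ g z₀) z₀ :=
    (contDiff_sigmaCoeff k).contDiffAt.hasStrictFDerivAt one_ne_zero
  have hgd : HasDerivAt (fun t : ℝ => g (z₀ + t • p)) (fderiv ℝ g z₀ p) 0 := by
    have h1 : HasDerivAt (fun t : ℝ => z₀ + t • p) p 0 := by
      simpa using ((hasDerivAt_id (0 : ℝ)).smul_const p).const_add z₀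
    have h2 : HasFDerivAt g (fderiv ℝ g z₀) (z₀ + (0 : ℝ) • p) := by
      simpa using hg.hasFDerivAt
    exact h2.comp_hasDerivAt 0 h1
  have hDD : fderiv ℝ g z₀ p = D := hgd.unique hD
  have hz : Tendsto z l (𝓝 z₀) := hZ
  have hpair : Tendsto (fun j => (z j + τ j • p, z j)) l (𝓝 (z₀, z₀)) := by
    refine Tendsto.prodMk_nhds ?_ hz
    simpa using hz.add (hτ.smul_const p)
  have ho := hg.isLittleO.comp_tendsto hpair
  have ho2 : (fun j => g (z j + τ j • p) - g (z j) - τ j * D) =o[l] fun j => τ j := by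
    have h3 : (fun j => τ j • p) =O[l] fun j => τ j := by
      refine Asymptotics.IsBigO.of_bound ‖p‖ (Eventually.of_forall fun j => ?_)
      rw [norm_smul, mul_comm]
    refine Asymptotics.IsLittleO.trans_isBigO ?_ h3
    refine (ho.congr_left fun j => ?_).congr_right fun j => ?_
    · simp [hDD]
    · simp
  have h4 := ho2.tendsto_inv_smul_nhds_zero
  have h5 := h4.add_const D
  rw [zero_add] at h5
  refine h5.congr' ?_
  filter_upwards [hτ0] with j hj
  simp only [smul_eq_mul]
  rw [mul_sub, inv_mul_cancel_left₀ hj, sub_add_cancel]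
  rfl

/-- A bound for `R` from the relations between consecutive elementary symmetric functions. -/
theorem bound_of_esymm_relations {l : ℕ} {α β γ R C₀ C₁ : ℝ} (hα : 0 < α) (hβ : 0 < β)
    (hR : 1 ≤ R) (hC₁ : 0 ≤ C₁) (hN : α * γ ≤ β ^ 2)
    (hM : β ^ l ≤ α ^ (l + 1)) (hQ : R ^ 2 * β + γ ≤ C₀ * R ^ (l + 2))
    (hD : R ^ 3 * α ≤ C₁ * (R ^ 2 * β + γ)) : R ≤ C₁ * C₀ * (1 + 2 * C₁) ^ l := by
  have hR0 : 0 < R := by linarith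
  -- Otherwise β < Rα. Then Newton bounds αγ by β² ≤ R²αβ, so `hD` multiplied by α gives Rα ≤ 2C₁β
  -- after all.
  have hδ : R * α ≤ (1 + 2 * C₁) * β := by
    by_contra! hlt
    have hb : β < R * α := by nlinarith
    have h1 : α * (R ^ 3 * α) ≤ C₁ * (R ^ 2 * β * α + β ^ 2) := by
      calc α * (R ^ 3 * α) ≤ α * (C₁ * (R ^ 2 * β + γ)) := by gcongr
        _ = C₁ * (R ^ 2 * β * α + α * γ) := by ring
        _ ≤ _ := by gcongr
    have h2 : β ^ 2 ≤ R ^ 2 * β * α := by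
      calc β ^ 2 = β * β := sq β
        _ ≤ β * (R * α) := by gcongr
        _ ≤ β * (R * (R * α)) := by
          have : R * α ≤ R * (R * α) := le_mul_of_one_le_left (by positivity) hR
          gcongr
        _ = _ := by ring
    have h3 : (R ^ 2 * α) * (R * α) ≤ (R ^ 2 * α) * (2 * C₁ * β) := by
      nlinarith [mul_le_mul_of_nonneg_left h2 hC₁]
    have h4 := le_of_mul_le_mul_left h3 (by positivity)
    linarith
  -- Maclaurin turns the bound on Rα/β into a lower bound for α; fed back into `hD` and `hQ`, it
  -- leaves one spare power of R.
  have h5 : R ^ l ≤ (1 + 2 * C₁) ^ l * α := by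
    have h6 : (R * α) ^ l ≤ ((1 + 2 * C₁) * β) ^ l := pow_le_pow_left₀ (by positivity) hδ l
    have h7 : α ^ l * R ^ l ≤ α ^ l * ((1 + 2 * C₁) ^ l * α) := by
      calc α ^ l * R ^ l = (R * α) ^ l := by ring
        _ ≤ ((1 + 2 * C₁) * β) ^ l := h6
        _ = (1 + 2 * C₁) ^ l * β ^ l := mul_pow _ _ _
        _ ≤ (1 + 2 * C₁) ^ l * α ^ (l + 1) := by gcongr
        _ = _ := by ring
    exact le_of_mul_le_mul_left h7 (by positivity)
  have h8 : R ^ (l + 2) * R ≤ R ^ (l + 2) * (C₁ * C₀ * (1 + 2 * C₁) ^ l) := by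
    calc R ^ (l + 2) * R = R ^ 3 * R ^ l := by ring
      _ ≤ R ^ 3 * ((1 + 2 * C₁) ^ l * α) := by gcongr
      _ = (1 + 2 * C₁) ^ l * (R ^ 3 * α) := by ring
      _ ≤ (1 + 2 * C₁) ^ l * (C₁ * (C₀ * R ^ (l + 2))) := by
        have : R ^ 3 * α ≤ C₁ * (C₀ * R ^ (l + 2)) := hD.trans (by gcongr)
        gcongr
      _ = _ := by ring
  exact le_of_mul_le_mul_left h8 (by positivity)

/-- The algebraic core of the gradient estimate for `k ≥ 2`. -/
theorem bound_of_derivative_bound {l : ℕ} (hl : l + 2 ≤ n + 1)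
    {W : Matrix (Fin (n + 1)) (Fin (n + 1)) ℝ} (hW : W.IsHermitian) (hG : InGamma (l + 2) W)
    {R C₀ C₁ D : ℝ} (hR : 1 ≤ R) (hC₁ : 0 ≤ C₁)
    (hrow : ∀ j, W 0 j = if j = 0 then R ^ 2 else 0)
    (hQ : sigma (l + 2) W ≤ C₀ * R ^ (l + 2))
    (hder : HasDerivAt (fun t : ℝ => sigmaCoeff (l + 2) (W + t • tailProj n)) D 0)
    (hD : R * D ≤ C₁ * sigma (l + 2) W) : R ≤ C₁ * C₀ * (1 + 2 * C₁) ^ l := by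
  obtain ⟨s, hs, hsig⟩ := exists_multiset_of_row_zero hW hrow
  have hsig0 : ∀ k, sigma k W = (R ^ 2 ::ₘ s).esymm k := fun k => by
    simpa using hsig k 0
  have hpos := Multiset.esymm_pos_of_cons (R ^ 2) s (l + 2) fun i hi => by
    rw [← hsig0]
    rcases Nat.eq_zero_or_pos i with rfl | h
    · rw [sigma_zero]; exact one_pos
    · exact hG i h hi
  have hherm : ∀ t : ℝ, (W + t • tailProj n).IsHermitian := fun t => by
    refine hW.add ?_
    rw [tailProj, ← diagonal_smul]
    exact isHermitian_diagonal _
  have hder' : HasDerivAt (fun t : ℝ => sigmaCoeff (l + 2) (W + t • tailProj n))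
      (R ^ 2 * (((n : ℝ) - l) * s.esymm l) + ((n : ℝ) - (l + 1 : ℕ)) * s.esymm (l + 1)) 0 := by
    have h1 := Multiset.hasDerivAt_esymm_map_add s l
    have h2 := Multiset.hasDerivAt_esymm_map_add s (l + 1)
    rw [hs] at h1 h2
    refine ((h1.const_mul (R ^ 2)).add h2).congr_of_eventuallyEq (Eventually.of_forall fun t => ?_)
    simp only [Pi.add_apply]
    rw [← sigma_eq_sigmaCoeff hl (hherm t), hsig, Multiset.esymm_cons_succ]
  have hDeq := hder.unique hder'
  have hα := hpos l (by omega)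
  have hβ := hpos (l + 1) (by omega)
  have hcast : (l : ℝ) + 1 ≤ n := by exact_mod_cast (by omega : l + 1 ≤ n)
  -- The coefficients n - l ≥ 1 and n - (l+1) ≥ 0 come from l + 2 ≤ n + 1; only the term carrying R²
  -- is kept.
  have hDge : R ^ 2 * s.esymm l ≤ D := by
    rw [hDeq]
    have h1 : 0 ≤ ((n : ℝ) - (l + 1 : ℕ)) * s.esymm (l + 1) :=
      mul_nonneg (by push_cast; linarith) hβ.le
    have h2 : s.esymm l ≤ ((n : ℝ) - l) * s.esymm l :=
      le_mul_of_one_le_left hα.le (by linarith)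
    nlinarith [mul_le_mul_of_nonneg_left h2 (sq_nonneg R)]
  rw [hsig0, Multiset.esymm_cons_succ] at hQ hD
  refine bound_of_esymm_relations hα hβ hR hC₁ (Multiset.esymm_mul_esymm_le s l)
    (Multiset.esymm_pow_le s l fun i hi => hpos i (by omega)) hQ ?_
  calc R ^ 3 * s.esymm l = R * (R ^ 2 * s.esymm l) := by ring
    _ ≤ R * D := by gcongr
    _ ≤ _ := hD

theorem sigma_one_eq_trace (W : Matrix (Fin (n + 1)) (Fin (n + 1)) ℝ) (hW : W.IsHermitian) :
    sigma 1 W = W.trace := by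
  rw [sigma_eq_sigmaCoeff (by omega) hW, sigmaCoeff, trace_eq_neg_charpoly_coeff]
  simp

end Sph

/-! ### Degree-zero extensions and Lipschitz bounds near the sphere. -/

namespace Sph

open Filter Topology Metric RealInnerProductSpace

section Ext

variable {n : ℕ}

theorem ext_coe (u : Sph n → ℝ) (x : Sph n) : ext u (x : EuclideanSpace ℝ (Fin (n + 1))) = u x := by
  have hx : ‖(x : EuclideanSpace ℝ (Fin (n + 1)))‖ = 1 := mem_sphere_zero_iff_norm.1 x.2
  have h0 : (x : EuclideanSpace ℝ (Fin (n + 1))) ≠ 0 := norm_ne_zero_iff.1 (by rw [hx]; simp)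
  rw [ext, dif_pos h0]
  congr 1
  ext1
  simp [hx]

theorem ext_smul (u : Sph n → ℝ) {t : ℝ} (ht : 0 < t) (y : EuclideanSpace ℝ (Fin (n + 1))) :
    ext u (t • y) = ext u y := by
  rcases eq_or_ne y 0 with rfl | hy
  · simp
  · rw [ext, ext, dif_pos hy, dif_pos (smul_ne_zero ht.ne' hy)]
    congr 1
    ext1
    simp only [norm_smul, Real.norm_eq_abs, abs_of_pos ht, smul_smul, mul_inv]
    congr 1
    field_simp

theorem ext_pos {u : Sph n → ℝ} (hu : ∀ x, 0 < u x) {y : EuclideanSpace ℝ (Fin (n + 1))}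
    (hy : y ≠ 0) : 0 < ext u y := by
  rw [ext, dif_pos hy]; exact hu _

theorem contDiffAt_ext {k : ℕ∞ω} {u : Sph n → ℝ} (hu : ContMDiff (𝓡 n) 𝓘(ℝ, ℝ) k u)
    {y : EuclideanSpace ℝ (Fin (n + 1))} (hy : y ≠ 0) : ContDiffAt ℝ k (ext u) y := by
  let U : TopologicalSpace.Opens (EuclideanSpace ℝ (Fin (n + 1))) := ⟨{0}ᶜ, isOpen_compl_singleton⟩
  have hn : ∀ z : U, ‖(z : EuclideanSpace ℝ (Fin (n + 1)))‖⁻¹ •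
      (z : EuclideanSpace ℝ (Fin (n + 1))) ∈ sphere (0 : EuclideanSpace ℝ (Fin (n + 1))) 1 := by
    intro z
    rw [mem_sphere_zero_iff_norm]
    have hz : (z : EuclideanSpace ℝ (Fin (n + 1))) ≠ 0 := z.2
    rw [norm_smul, norm_inv, norm_norm, inv_mul_cancel₀ (norm_ne_zero_iff.mpr hz)]
  have h1 : ContMDiff 𝓘(ℝ, EuclideanSpace ℝ (Fin (n + 1))) 𝓘(ℝ, EuclideanSpace ℝ (Fin (n + 1))) k
      (fun z : U => ‖(z : EuclideanSpace ℝ (Fin (n + 1)))‖⁻¹ •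
        (z : EuclideanSpace ℝ (Fin (n + 1)))) := by
    intro z
    have hz : (z : EuclideanSpace ℝ (Fin (n + 1))) ≠ 0 := z.2
    refine (contMDiffAt_subtype_iff
      (f := fun z : EuclideanSpace ℝ (Fin (n + 1)) => ‖z‖⁻¹ • z)).2 ?_
    rw [contMDiffAt_iff_contDiffAt]
    exact ((contDiffAt_norm ℝ hz).inv (norm_ne_zero_iff.2 hz)).smul contDiffAt_id
  have : Fact (Module.finrank ℝ (EuclideanSpace ℝ (Fin (n + 1))) = n + 1) :=
    ⟨finrank_euclideanSpace_fin⟩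
  have h2 := ContMDiff.codRestrict_sphere (n := n) h1 hn
  have h3 := (hu.comp h2) ⟨y, hy⟩
  have h4 : ContMDiffAt 𝓘(ℝ, EuclideanSpace ℝ (Fin (n + 1))) 𝓘(ℝ, ℝ) k
      (fun z : U => ext u (z : EuclideanSpace ℝ (Fin (n + 1)))) ⟨y, hy⟩ := by
    refine h3.congr_of_eventuallyEq (Eventually.of_forall fun z => ?_)
    have hz : (z : EuclideanSpace ℝ (Fin (n + 1))) ≠ 0 := z.2
    simp only [ext, dif_pos hz, Function.comp_apply, Set.codRestrict]
  exact contMDiffAt_iff_contDiffAt.1 (contMDiffAt_subtype_iff.1 h4)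

theorem norm_grad (u : Sph n → ℝ) (x : Sph n) :
    ‖grad u x‖ = ‖fderiv ℝ (ext u) (x : EuclideanSpace ℝ (Fin (n + 1)))‖ := by
  rw [grad, gradient, LinearIsometryEquiv.norm_map]

end Ext

section Homogeneous

variable {E : Type*} [NormedAddCommGroup E] [InnerProductSpace ℝ E]

theorem fderiv_smul_of_homogeneous {f : E → ℝ} (hom : ∀ t : ℝ, 0 < t → ∀ y, f (t • y) = f y)
    {t : ℝ} (ht : 0 < t) (y : E) : fderiv ℝ f (t • y) = t⁻¹ • fderiv ℝ f y := by
  have h : (fun z => f (t • z)) = f := funext fun z => hom t ht z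
  have h2 := fderiv_comp_smul (𝕜 := ℝ) (f := f) (x := y) t
  rw [h] at h2
  rw [h2, smul_smul, inv_mul_cancel₀ ht.ne', one_smul]

theorem fderiv_self_of_homogeneous {f : E → ℝ} (hom : ∀ t : ℝ, 0 < t → ∀ y, f (t • y) = f y)
    {y : E} (hf : DifferentiableAt ℝ f y) : fderiv ℝ f y y = 0 := by
  have h1 : HasDerivAt (fun t : ℝ => t • y) y 1 := by
    simpa using (hasDerivAt_id (1 : ℝ)).smul_const y
  have h2 : HasFDerivAt f (fderiv ℝ f y) ((1 : ℝ) • y) := by simpa using hf.hasFDerivAt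
  have h3 := h2.comp_hasDerivAt 1 h1
  have h4 : (f ∘ fun t : ℝ => t • y) =ᶠ[𝓝 1] fun _ => f y := by
    filter_upwards [lt_mem_nhds one_pos] with t ht
    exact hom t ht y
  exact h3.unique ((hasDerivAt_const (1 : ℝ) (f y)).congr_of_eventuallyEq h4)

theorem norm_fderiv_le_div_norm {f : E → ℝ} (hom : ∀ t : ℝ, 0 < t → ∀ y, f (t • y) = f y)
    {G : ℝ} (hG : ∀ x : E, ‖x‖ = 1 → ‖fderiv ℝ f x‖ ≤ G) {y : E} (hy : y ≠ 0) :
    ‖fderiv ℝ f y‖ ≤ G / ‖y‖ := by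
  have hy' := norm_pos_iff.2 hy
  have h1 : y = ‖y‖ • (‖y‖⁻¹ • y) := by
    rw [smul_smul, mul_inv_cancel₀ hy'.ne', one_smul]
  have h2 := hG (‖y‖⁻¹ • y) (by rw [norm_smul, norm_inv, norm_norm, inv_mul_cancel₀ hy'.ne'])
  rw [h1, fderiv_smul_of_homogeneous hom hy', norm_smul, norm_inv, norm_norm, ← h1, div_eq_inv_mul]
  gcongr

theorem abs_sub_le_of_segment {f : E → ℝ} (hom : ∀ t : ℝ, 0 < t → ∀ y, f (t • y) = f y)
    (hf : ∀ y, y ≠ 0 → DifferentiableAt ℝ f y)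
    {G : ℝ} (hG : ∀ x : E, ‖x‖ = 1 → ‖fderiv ℝ f x‖ ≤ G) (hG0 : 0 ≤ G) {δ : ℝ} (hδ : 0 < δ) {x y : E}
    (hseg : ∀ z ∈ segment ℝ y x, δ ≤ ‖z‖) : |f x - f y| ≤ G / δ * ‖x - y‖ := by
  have h0 : ∀ z ∈ segment ℝ y x, z ≠ 0 := fun z hz =>
    norm_pos_iff.1 (hδ.trans_le (hseg z hz))
  refine (convex_segment y x).norm_image_sub_le_of_norm_fderiv_le (𝕜 := ℝ)
    (fun z hz => hf z (h0 z hz)) (fun z hz => ?_)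
    (left_mem_segment ℝ y x) (right_mem_segment ℝ y x)
  refine (norm_fderiv_le_div_norm hom hG (h0 z hz)).trans ?_
  have := hseg z hz
  gcongr

/-- The chord stays outside the ball of radius 1 - r, r = |x-y|, where the gradient is at most
G/(1-r). The factor 1 + 2r tends to 1, so the sharp constant G survives in the limit, which κ|x-y| →
L requires. -/
theorem abs_sub_le_of_near {f : E → ℝ} (hom : ∀ t : ℝ, 0 < t → ∀ y, f (t • y) = f y)
    (hf : ∀ y, y ≠ 0 → DifferentiableAt ℝ f y)
    {G : ℝ} (hG : ∀ x : E, ‖x‖ = 1 → ‖fderiv ℝ f x‖ ≤ G) (hG0 : 0 ≤ G) {x y : E}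
    (hx : ‖x‖ = 1) (hr : ‖x - y‖ ≤ 1 / 2) :
    |f x - f y| ≤ G * ‖x - y‖ * (1 + 2 * ‖x - y‖) := by
  have h := abs_sub_le_of_segment hom hf hG hG0 (δ := 1 - ‖x - y‖) (x := x) (y := y)
    (by linarith) fun z hz => by
      have h1 : ‖z - x‖ ≤ ‖x - y‖ := by
        obtain ⟨a, b, ha, hb, hab, rfl⟩ := hz
        have : a • y + b • x - x = a • (y - x) := by
          rw [eq_sub_of_add_eq' hab, sub_smul, one_smul, smul_sub]; abel
        rw [this, norm_smul, Real.norm_of_nonneg ha, norm_sub_rev y x]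
        exact mul_le_of_le_one_left (norm_nonneg _) (by linarith)
      have h2 := norm_sub_norm_le x z
      rw [norm_sub_rev] at h2
      linarith
  refine h.trans ?_
  have hr0 := norm_nonneg (x - y)
  have h3 : (1 - ‖x - y‖)⁻¹ ≤ 1 + 2 * ‖x - y‖ := by
    rw [inv_le_iff_one_le_mul₀ (by linarith)]
    nlinarith
  calc G / (1 - ‖x - y‖) * ‖x - y‖ = G * ‖x - y‖ * (1 - ‖x - y‖)⁻¹ := by
        rw [div_eq_mul_inv]; ring
    _ ≤ _ := by gcongr

/-- For an angle of at most π/2 the chord keeps distance at least 1/2 from the origin, and its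
length is at most 2. -/
theorem abs_sub_le_of_inner_nonneg {f : E → ℝ} (hom : ∀ t : ℝ, 0 < t → ∀ y, f (t • y) = f y)
    (hf : ∀ y, y ≠ 0 → DifferentiableAt ℝ f y)
    {G : ℝ} (hG : ∀ x : E, ‖x‖ = 1 → ‖fderiv ℝ f x‖ ≤ G) (hG0 : 0 ≤ G) {x y : E}
    (hx : ‖x‖ = 1) (hy : ‖y‖ = 1) (h : 0 ≤ ⟪x, y⟫) : |f x - f y| ≤ 4 * G := by
  have h := abs_sub_le_of_segment hom hf hG hG0 (δ := 1 / 2) (x := x) (y := y)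
    (by norm_num) fun z hz => by
      obtain ⟨a, b, ha, hb, hab, rfl⟩ := hz
      have h1 : ‖a • y + b • x‖ ^ 2 = a ^ 2 + b ^ 2 + 2 * (a * b * ⟪x, y⟫) := by
        rw [norm_add_sq_real, norm_smul, norm_smul, hx, hy, real_inner_smul_left,
          real_inner_smul_right, real_inner_comm x y, mul_one, mul_one, Real.norm_eq_abs,
          Real.norm_eq_abs, sq_abs, sq_abs]
        ring
      have h2 : 0 ≤ a * b * ⟪x, y⟫ := by positivity
      refine (sq_le_sq₀ (by norm_num) (norm_nonneg _)).1 ?_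
      rw [h1]
      nlinarith [sq_nonneg (a - b)]
  have h2 : ‖x - y‖ ≤ 2 := (norm_sub_le x y).trans (by rw [hx, hy]; norm_num)
  calc _ ≤ _ := h
    _ ≤ G / (1 / 2) * 2 := by gcongr
    _ = _ := by ring

end Homogeneous

/-! ### First and second variation of the doubled functional. -/

section Variation

theorem second_derivative_test {g g' : ℝ → ℝ} {g₂ : ℝ} (hmax : IsLocalMax g 0)
    (h1 : ∀ᶠ t in 𝓝 0, HasDerivAt g (g' t) t) (h2 : HasDerivAt g' g₂ 0) :
    g' 0 = 0 ∧ g₂ ≤ 0 := by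
  have h10 := h1.self_of_nhds
  have h0 : g' 0 = 0 := by
    rw [← h10.deriv]; exact hmax.deriv_eq_zero
  refine ⟨h0, ?_⟩
  by_contra! hpos
  have hd : deriv g =ᶠ[𝓝 0] g' := h1.mono fun t ht => ht.deriv
  have hdd : deriv (deriv g) 0 = g₂ := by rw [hd.deriv_eq, h2.deriv]
  -- A positive second derivative makes 0 a local minimum too, so g is constant nearby and the
  -- second derivative vanishes.
  have hmin := isLocalMin_of_deriv_deriv_pos (by rw [hdd]; exact hpos)
    (by rw [h10.deriv, h0]) h10.continuousAt
  have hc : g =ᶠ[𝓝 0] fun _ => g 0 := by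
    filter_upwards [hmax, hmin] with t ha hb using le_antisymm ha hb
  have hd2 : deriv g =ᶠ[𝓝 0] fun _ => 0 := by
    refine hc.deriv.trans ?_
    simp
  rw [hd2.deriv_eq] at hdd
  simp at hdd
  linarith

variable {E : Type*} [NormedAddCommGroup E] [InnerProductSpace ℝ E]

theorem hasDerivAt_along_line {f : E → ℝ} (hf : ∀ y, y ≠ 0 → ContDiffAt ℝ 2 f y) {x : E}
    (hx : x ≠ 0) (ξ : E) :
    (∀ᶠ t in 𝓝 (0 : ℝ), HasDerivAt (fun t : ℝ => f (x + t • ξ)) (fderiv ℝ f (x + t • ξ) ξ) t) ∧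
    ∀ v : E, HasDerivAt (fun t : ℝ => fderiv ℝ f (x + t • ξ) v) (fderiv ℝ (fderiv ℝ f) x ξ v) 0 := by
  have hline : ∀ t : ℝ, HasDerivAt (fun t : ℝ => x + t • ξ) ξ t := fun t => by
    simpa using ((hasDerivAt_id t).smul_const ξ).const_add x
  constructor
  · have hc : ∀ᶠ t in 𝓝 (0 : ℝ), x + t • ξ ≠ 0 :=
      (hline 0).continuousAt.eventually_ne (by simpa using hx)
    filter_upwards [hc] with t ht
    exact (((hf _ ht).differentiableAt two_ne_zero).hasFDerivAt).comp_hasDerivAt t (hline t)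
  · intro v
    have h1 : HasFDerivAt (fderiv ℝ f) (fderiv ℝ (fderiv ℝ f) x) (x + (0 : ℝ) • ξ) := by
      have h2 : ContDiffAt ℝ 1 (fderiv ℝ f) x := (hf x hx).fderiv_right (by norm_num)
      simpa using (h2.differentiableAt one_ne_zero).hasFDerivAt
    have h2 : HasDerivAt (fun t : ℝ => fderiv ℝ f (x + t • ξ)) (fderiv ℝ (fderiv ℝ f) x ξ) 0 :=
      h1.comp_hasDerivAt 0 (hline 0)
    simpa using h2.clm_apply (hasDerivAt_const 0 v)

/-- First and second variation at a maximum of `f x - f y + κ cos ∠(x, y)`. -/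
theorem variation_of_doubled_max {f : E → ℝ} (hf : ∀ y, y ≠ 0 → ContDiffAt ℝ 2 f y) {κ : ℝ}
    (hκ : 0 ≤ κ) {x y : E} (hx : ‖x‖ = 1) (hy : ‖y‖ = 1)
    (hmax : ∀ x' y' : E, x' ≠ 0 → y' ≠ 0 →
      f x' - f y' + κ * (⟪x', y'⟫ / (‖x'‖ * ‖y'‖)) ≤ f x - f y + κ * ⟪x, y⟫)
    (hc : 0 < ⟪x, y⟫) {ξ η : E} (hξ : ⟪x, ξ⟫ = 0) (hη : ⟪y, η⟫ = 0) :
    fderiv ℝ f x ξ - fderiv ℝ f y η + κ * (⟪x, η⟫ + ⟪ξ, y⟫) = 0 ∧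
    fderiv ℝ (fderiv ℝ f) x ξ ξ - fderiv ℝ (fderiv ℝ f) y η η +
      κ * (2 * ⟪ξ, η⟫ - ⟪x, y⟫ * (‖ξ‖ ^ 2 + ‖η‖ ^ 2)) ≤ 0 := by
  have hx0 : x ≠ 0 := norm_ne_zero_iff.1 (by rw [hx]; simp)
  have hy0 : y ≠ 0 := norm_ne_zero_iff.1 (by rw [hy]; simp)
  set c := ⟪x, y⟫
  set m := ⟪x, η⟫ + ⟪ξ, y⟫ with hm
  set q := ⟪ξ, η⟫
  set d := (‖ξ‖ ^ 2 + ‖η‖ ^ 2) / 2 with hd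
  obtain ⟨hx1, hx2⟩ := hasDerivAt_along_line hf hx0 ξ
  obtain ⟨hy1, hy2⟩ := hasDerivAt_along_line hf hy0 η
  have hp : ∀ t : ℝ, HasDerivAt (fun t : ℝ => κ * ((c + m * t + q * t ^ 2) * (1 - d * t ^ 2)))
      (κ * ((m + 2 * q * t) * (1 - d * t ^ 2) + (c + m * t + q * t ^ 2) * (-(2 * d * t)))) t := by
    intro t
    have hid := hasDerivAt_id t
    have h1 := ((hid.const_mul m).const_add c).add ((hid.pow 2).const_mul q)
    have h2 := ((hid.pow 2).const_mul d).const_sub 1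
    refine ((h1.mul h2).const_mul κ).congr_deriv ?_
    simp only [Pi.add_apply, Pi.pow_apply, id_eq, Nat.cast_ofNat, pow_one,
      Nat.add_one_sub_one]
    ring
  have hp2 : HasDerivAt (fun t : ℝ => κ * ((m + 2 * q * t) * (1 - d * t ^ 2) +
      (c + m * t + q * t ^ 2) * (-(2 * d * t)))) (κ * (2 * q - 2 * d * c)) 0 := by
    have hid := hasDerivAt_id (0 : ℝ)
    have h1 := ((hid.const_mul m).const_add c).add ((hid.pow 2).const_mul q)
    have h2 := ((hid.pow 2).const_mul d).const_sub 1
    have h3 := (hid.const_mul (2 * q)).const_add m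
    have h4 := (hid.const_mul (2 * d)).neg
    refine (((h3.mul h2).add (h1.mul h4)).const_mul κ).congr_deriv ?_
    simp only [Pi.add_apply, Pi.neg_apply, Pi.pow_apply, id_eq, Nat.cast_ofNat, pow_one,
      Nat.add_one_sub_one]
    ring
  -- The cosine along the two lines is replaced by a polynomial minorant that agrees with it at t =
  -- 0. The maximum is therefore inherited, and no quotient has to be differentiated twice.
  have hlm : IsLocalMax (fun t : ℝ => f (x + t • ξ) - f (y + t • η) +
      κ * ((c + m * t + q * t ^ 2) * (1 - d * t ^ 2))) 0 := by
    have hnum : ∀ᶠ t in 𝓝 (0 : ℝ), 0 < c + m * t + q * t ^ 2 := by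
      have : ContinuousAt (fun t : ℝ => c + m * t + q * t ^ 2) 0 := by fun_prop
      exact this.eventually (lt_mem_nhds (by simpa using hc))
    filter_upwards [hnum] with t ht
    have hnx : ‖x + t • ξ‖ ^ 2 = 1 + t ^ 2 * ‖ξ‖ ^ 2 := by
      rw [norm_add_sq_real, real_inner_smul_right, hξ, hx, norm_smul, mul_pow, Real.norm_eq_abs,
        sq_abs]; ring
    have hny : ‖y + t • η‖ ^ 2 = 1 + t ^ 2 * ‖η‖ ^ 2 := by
      rw [norm_add_sq_real, real_inner_smul_right, hη, hy, norm_smul, mul_pow, Real.norm_eq_abs,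
        sq_abs]; ring
    have hinn : ⟪x + t • ξ, y + t • η⟫ = c + m * t + q * t ^ 2 := by
      rw [inner_add_left, inner_add_right, inner_add_right, real_inner_smul_left,
        real_inner_smul_left, real_inner_smul_right, real_inner_smul_right, hm]
      ring
    have hA : 1 ≤ ‖x + t • ξ‖ := by
      have : 0 ≤ t ^ 2 * ‖ξ‖ ^ 2 := by positivity
      exact (sq_le_sq₀ zero_le_one (norm_nonneg _)).1 (by rw [hnx, one_pow]; linarith)
    have hB : 1 ≤ ‖y + t • η‖ := by
      have : 0 ≤ t ^ 2 * ‖η‖ ^ 2 := by positivity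
      exact (sq_le_sq₀ zero_le_one (norm_nonneg _)).1 (by rw [hny, one_pow]; linarith)
    -- The product of the norms is at most their mean square 1 + d t², and (1 - d t²)(1 + d t²) ≤ 1.
    have hAB : 1 - d * t ^ 2 ≤ (‖x + t • ξ‖ * ‖y + t • η‖)⁻¹ := by
      set A := ‖x + t • ξ‖
      set B := ‖y + t • η‖
      have hAB0 : A * B ≤ 1 + d * t ^ 2 := by
        rw [hd]; nlinarith [sq_nonneg (A - B)]
      have hdt : 0 ≤ d * t ^ 2 := by positivity
      have hAB1 : 0 < A * B := by positivity
      rw [inv_eq_one_div, le_div_iff₀ hAB1]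
      rcases le_or_gt (1 - d * t ^ 2) 0 with h0 | h0
      · exact (mul_nonpos_of_nonpos_of_nonneg h0 hAB1.le).trans zero_le_one
      · nlinarith [mul_le_mul_of_nonneg_left hAB0 h0.le]
    have h := hmax (x + t • ξ) (y + t • η) (norm_pos_iff.1 (by linarith))
      (norm_pos_iff.1 (by linarith))
    rw [hinn, div_eq_mul_inv] at h
    have h5 : κ * ((c + m * t + q * t ^ 2) * (1 - d * t ^ 2)) ≤
        κ * ((c + m * t + q * t ^ 2) * (‖x + t • ξ‖ * ‖y + t • η‖)⁻¹) := by gcongr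
    simp only [zero_smul, add_zero, mul_zero, ne_eq, OfNat.ofNat_ne_zero, not_false_eq_true,
      zero_pow, sub_zero, mul_one]
    linarith
  have h := second_derivative_test hlm
    (by
      filter_upwards [hx1, hy1] with t h1 h2
      exact (h1.sub h2).add (hp t))
    (((hx2 ξ).sub (hy2 η)).add hp2)
  constructor
  · simpa using h.1
  · have h2 := h.2
    have e : κ * (2 * q - 2 * d * c) = κ * (2 * q - c * (‖ξ‖ ^ 2 + ‖η‖ ^ 2)) := by
      rw [hd]; ring
    rw [e] at h2
    exact h2

end Variation

end Sph

/-! ### Maximizing pairs as κ → ∞. -/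

namespace Sph

open Filter Topology Metric RealInnerProductSpace

section Doubling

variable {E : Type*} [NormedAddCommGroup E] [InnerProductSpace ℝ E]

theorem inner_eq_of_norm_eq_one {x y : E} (hx : ‖x‖ = 1) (hy : ‖y‖ = 1) :
    ⟪x, y⟫ = 1 - ‖x - y‖ ^ 2 / 2 := by
  rw [norm_sub_sq_real, hx, hy]; ring

/-- `(x, y)` maximizes `f x - f y + κ cos ∠(x, y)`. -/
def IsDoubledMax (f : E → ℝ) (κ : ℝ) (x y : E) : Prop :=
  ∀ x' y' : E, x' ≠ 0 → y' ≠ 0 →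
    f x' - f y' + κ * (⟪x', y'⟫ / (‖x'‖ * ‖y'‖)) ≤ f x - f y + κ * ⟪x, y⟫

theorem exists_isDoubledMax [FiniteDimensional ℝ E] [Nontrivial E] {f : E → ℝ}
    (hom : ∀ t : ℝ, 0 < t → ∀ y, f (t • y) = f y) (hf : ∀ y, y ≠ 0 → ContinuousAt f y) (κ : ℝ) :
    ∃ x y : E, ‖x‖ = 1 ∧ ‖y‖ = 1 ∧ IsDoubledMax f κ x y := by
  have hS : IsCompact (sphere (0 : E) 1) := isCompact_sphere 0 1
  have h0 : ∀ x : E, ‖x‖ = 1 → x ≠ 0 := fun x hx => norm_ne_zero_iff.1 (by rw [hx]; simp)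
  have hfc : ContinuousOn f (sphere (0 : E) 1) := fun x hx =>
    (hf x (h0 x (mem_sphere_zero_iff_norm.1 hx))).continuousWithinAt
  have hc : ContinuousOn (fun p : E × E => f p.1 - f p.2 + κ * ⟪p.1, p.2⟫)
      (sphere (0 : E) 1 ×ˢ sphere (0 : E) 1) := by
    refine ContinuousOn.add (ContinuousOn.sub ?_ ?_) ?_
    · exact hfc.comp continuousOn_fst fun p hp => hp.1
    · exact hfc.comp continuousOn_snd fun p hp => hp.2
    · exact (continuous_const.mul (continuous_fst.inner continuous_snd)).continuousOn
  obtain ⟨p, hp, hmax⟩ := (hS.prod hS).exists_isMaxOn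
    ((NormedSpace.sphere_nonempty.2 zero_le_one).prod
      (NormedSpace.sphere_nonempty.2 zero_le_one)) hc
  refine ⟨p.1, p.2, mem_sphere_zero_iff_norm.1 hp.1, mem_sphere_zero_iff_norm.1 hp.2, ?_⟩
  intro x' y' hx' hy'
  have hx := norm_pos_iff.2 hx'
  have hy := norm_pos_iff.2 hy'
  have h1 : ∀ z : E, z ≠ 0 → ‖‖z‖⁻¹ • z‖ = 1 := fun z hz => by
    rw [norm_smul, norm_inv, norm_norm, inv_mul_cancel₀ (norm_ne_zero_iff.2 hz)]
  have h2 := hmax (show (‖x'‖⁻¹ • x', ‖y'‖⁻¹ • y') ∈ _ from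
    ⟨mem_sphere_zero_iff_norm.2 (h1 x' hx'), mem_sphere_zero_iff_norm.2 (h1 y' hy')⟩)
  simp only [Set.mem_ofPred_eq, hom _ (inv_pos.2 hx), hom _ (inv_pos.2 hy), real_inner_smul_left,
    real_inner_smul_right] at h2
  refine le_trans (le_of_eq ?_) h2
  field_simp

theorem exists_unit_tangent_direction [FiniteDimensional ℝ E] {f : E → ℝ}
    (hom : ∀ t : ℝ, 0 < t → ∀ y, f (t • y) = f y) {z : E} (hf : DifferentiableAt ℝ f z) {L : ℝ}
    (hL : 0 < L) (hz : ‖fderiv ℝ f z‖ = L) :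
    ∃ ν : E, ‖ν‖ = 1 ∧ ⟪z, ν⟫ = 0 ∧ fderiv ℝ f z ν = L := by
  set g := (InnerProductSpace.toDual ℝ E).symm (fderiv ℝ f z) with hg
  have hgi : ∀ v, ⟪g, v⟫ = fderiv ℝ f z v := fun v => by
    rw [hg, InnerProductSpace.toDual_symm_apply]
  have hgn : ‖g‖ = L := by rw [hg, LinearIsometryEquiv.norm_map, hz]
  refine ⟨L⁻¹ • g, ?_, ?_, ?_⟩
  · rw [norm_smul, hgn, norm_inv, Real.norm_of_nonneg hL.le, inv_mul_cancel₀ hL.ne']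
  · rw [real_inner_smul_right, real_inner_comm, hgi, fderiv_self_of_homogeneous hom hf, mul_zero]
  · rw [← hgi, real_inner_smul_right, real_inner_self_eq_norm_sq, hgn]
    field_simp

/-- With r = |x-y|, the maximum exceeds the diagonal value by at most L r(1+2r) - κr²/2, while a
step of length L/κ from z along the gradient gains L²/(2κ) - o(1/κ). Multiplying by 2κ and
completing the square gives (κr - L)² → 0. -/
theorem exists_doubled_max_sequence [FiniteDimensional ℝ E] [Nontrivial E] {f : E → ℝ}
    (hom : ∀ t : ℝ, 0 < t → ∀ y, f (t • y) = f y) (hf : ∀ y, y ≠ 0 → DifferentiableAt ℝ f y)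
    {L : ℝ} (hL : 0 < L) (hG : ∀ x : E, ‖x‖ = 1 → ‖fderiv ℝ f x‖ ≤ L) {z : E} (hz : ‖z‖ = 1)
    (hzL : ‖fderiv ℝ f z‖ = L) :
    ∃ (κ : ℕ → ℝ) (x y : ℕ → E), (∀ j, 0 < κ j) ∧ (∀ j, ‖x j‖ = 1) ∧ (∀ j, ‖y j‖ = 1) ∧
      (∀ j, IsDoubledMax f (κ j) (x j) (y j)) ∧
      Tendsto (fun j => ‖x j - y j‖) atTop (𝓝 0) ∧
      Tendsto (fun j => κ j * ‖x j - y j‖) atTop (𝓝 L) := by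
  have h0 : ∀ x : E, ‖x‖ = 1 → x ≠ 0 := fun x hx => norm_ne_zero_iff.1 (by rw [hx]; simp)
  have hex := fun j : ℕ =>
    exists_isDoubledMax hom (fun y hy => (hf y hy).continuousAt) ((j : ℝ) + 1)
  choose x y hx hy hmax using hex
  have hκ0 : ∀ j : ℕ, (0 : ℝ) < (j : ℝ) + 1 := fun j => by positivity
  have hκ : Tendsto (fun j : ℕ => (j : ℝ) + 1) atTop atTop :=
    tendsto_atTop_add_const_right _ _ tendsto_natCast_atTop_atTop
  refine ⟨fun j => (j : ℝ) + 1, x, y, hκ0, hx, hy, hmax, ?_⟩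
  set r : ℕ → ℝ := fun j => ‖x j - y j‖ with hr
  have hr0 : ∀ j, 0 ≤ r j := fun j => norm_nonneg _
  have hin : ∀ j, ⟪x j, y j⟫ = 1 - r j ^ 2 / 2 := fun j => inner_eq_of_norm_eq_one (hx j) (hy j)
  -- Comparison with the diagonal pair (x, x).
  have hdiag : ∀ j : ℕ, ((j : ℝ) + 1) * (r j ^ 2 / 2) ≤ f (x j) - f (y j) := by
    intro j
    have h1 := hmax j (x j) (x j) (h0 _ (hx j)) (h0 _ (hx j))
    rw [hin, real_inner_self_eq_norm_sq, hx] at h1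
    norm_num at h1
    linarith
  obtain ⟨M, hM⟩ : ∃ M, ∀ x : E, ‖x‖ = 1 → |f x| ≤ M := by
    obtain ⟨M, hM⟩ := (isCompact_sphere (0 : E) 1).exists_bound_of_continuousOn (f := f)
      fun x hx => (hf x (h0 x (mem_sphere_zero_iff_norm.1 hx))).continuousAt.continuousWithinAt
    exact ⟨M, fun x hx => hM x (mem_sphere_zero_iff_norm.2 hx)⟩
  have hr2 : Tendsto (fun j => r j ^ 2) atTop (𝓝 0) := by
    refine squeeze_zero (fun j => sq_nonneg _) (fun j => ?_)
      (g := fun j : ℕ => 4 * M / ((j : ℝ) + 1)) (hκ.const_div_atTop _)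
    rw [le_div_iff₀ (hκ0 j)]
    have h1 := hdiag j
    have h2 := abs_le.1 (hM _ (hx j))
    have h3 := abs_le.1 (hM _ (hy j))
    nlinarith
  have hrt : Tendsto r atTop (𝓝 0) := by
    have := hr2.sqrt
    simpa [Real.sqrt_sq (hr0 _)] using this
  refine ⟨hrt, ?_⟩
  have hup : ∀ᶠ j in atTop, f (x j) - f (y j) ≤ L * r j * (1 + 2 * r j) := by
    filter_upwards [hrt.eventually (ge_mem_nhds (show (0 : ℝ) < 1 / 2 by norm_num))] with j hj
    exact (le_abs_self _).trans (abs_sub_le_of_near hom hf hG hL.le (hx j) hj)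
  have hqb : ∀ᶠ j : ℕ in atTop, ((j : ℝ) + 1) * r j ≤ 4 * L := by
    filter_upwards [hup, hrt.eventually (ge_mem_nhds (show (0 : ℝ) < 1 / 2 by norm_num))] with j h1 hj
    have h2 := hdiag j
    rcases (hr0 j).eq_or_lt with h3 | h3
    · rw [← h3]; linarith
    · have h4 : r j * (((j : ℝ) + 1) * r j) ≤ r j * (4 * L) := by
        have h5 : L * r j * (2 * r j) ≤ L * r j * 1 := by gcongr; linarith
        nlinarith
      exact le_of_mul_le_mul_left h4 h3
  obtain ⟨ν, hν1, hν2, hν3⟩ := exists_unit_tangent_direction hom (hf z (h0 z hz)) hL hzL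
  -- The step t = L/κ maximizes L t - κt²/2, the expected gain minus the penalty.
  set a : ℕ → ℝ := fun j => ((j : ℝ) + 1) * (f (z + (L / ((j : ℝ) + 1)) • ν) - f z) with ha
  have hat : Tendsto a atTop (𝓝 (L * L)) := by
    have h1 : HasDerivAt (fun t : ℝ => z + t • ν) ν 0 := by
      simpa using ((hasDerivAt_id (0 : ℝ)).smul_const ν).const_add z
    have h2 : HasFDerivAt f (fderiv ℝ f z) (z + (0 : ℝ) • ν) := by
      simpa using (hf z (h0 z hz)).hasFDerivAt
    have h3 : HasDerivAt (fun t : ℝ => f (z + t • ν)) L 0 := hν3 ▸ h2.comp_hasDerivAt 0 h1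
    have h4 : Tendsto (fun j : ℕ => L / ((j : ℝ) + 1)) atTop (𝓝[≠] 0) := by
      refine tendsto_nhdsWithin_iff.2 ⟨hκ.const_div_atTop _, Eventually.of_forall fun j => ?_⟩
      exact (div_pos hL (hκ0 j)).ne'
    have h5 := ((hasDerivAt_iff_tendsto_slope.1 h3).comp h4).const_mul L
    refine h5.congr fun j => ?_
    have := hκ0 j
    simp only [Function.comp_apply, slope_def_field, ha, zero_smul, add_zero, sub_zero]
    field_simp
  have hlow : ∀ᶠ j : ℕ in atTop,
      (((j : ℝ) + 1) * r j - L) ^ 2 ≤ 16 * L ^ 2 * r j + 2 * (L * L - a j) := by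
    filter_upwards [hup, hqb] with j h1 h2
    set K := (j : ℝ) + 1 with hK
    have hK0 : 0 < K := hκ0 j
    set t := L / K with ht
    have hKt : K * t = L := by rw [ht]; field_simp
    have hn2 : ‖z + t • ν‖ ^ 2 = 1 + t ^ 2 := by
      rw [norm_add_sq_real, real_inner_smul_right, hν2, hz, norm_smul, hν1, Real.norm_eq_abs,
        mul_one, sq_abs]; ring
    have hn1 : 1 ≤ ‖z + t • ν‖ :=
      (sq_le_sq₀ zero_le_one (norm_nonneg _)).1 (by rw [hn2, one_pow]; linarith [sq_nonneg t])
    have hin2 : ⟪z + t • ν, z⟫ = 1 := by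
      rw [inner_add_left, real_inner_smul_left, real_inner_comm z ν, hν2,
        real_inner_self_eq_norm_sq, hz]; ring
    have h3 := hmax j (z + t • ν) z (norm_pos_iff.1 (by linarith)) (h0 z hz)
    rw [hin2, hz, hin, mul_one, one_div, ← hK] at h3
    have h4 : 1 - t ^ 2 / 2 ≤ ‖z + t • ν‖⁻¹ := by
      rw [inv_eq_one_div, le_div_iff₀ (by linarith)]
      set A := ‖z + t • ν‖
      have ht2 : t ^ 2 = A ^ 2 - 1 := by linarith
      rw [ht2]
      nlinarith [mul_nonneg (mul_nonneg (sub_nonneg.2 hn1) (sub_nonneg.2 hn1))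
        (by linarith : 0 ≤ A + 2)]
    have h5 : a j - L ^ 2 / 2 ≤ L * (K * r j) * (1 + 2 * r j) - (K * r j) ^ 2 / 2 := by
      have h6 : K * (1 - t ^ 2 / 2) ≤ K * ‖z + t • ν‖⁻¹ := by gcongr
      have h7 : f (z + t • ν) - f z - K * t ^ 2 / 2 ≤ L * r j * (1 + 2 * r j) - K * r j ^ 2 / 2 := by
        linarith
      have h8 := mul_le_mul_of_nonneg_left h7 hK0.le
      have h9 : a j = K * (f (z + t • ν) - f z) := rfl
      rw [h9, ← hKt]
      rw [← hKt] at h8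
      nlinarith
    have h10 : L * (K * r j) * r j ≤ L * (4 * L) * r j := by
      have := hr0 j
      gcongr
    nlinarith
  have hsq : Tendsto (fun j : ℕ => (((j : ℝ) + 1) * r j - L) ^ 2) atTop (𝓝 0) := by
    refine squeeze_zero' (Eventually.of_forall fun j => sq_nonneg _) hlow ?_
    have := (hrt.const_mul (16 * L ^ 2)).add ((hat.const_sub (L * L)).const_mul 2)
    simpa using this
  have habs : Tendsto (fun j : ℕ => ((j : ℝ) + 1) * r j - L) atTop (𝓝 0) := by
    rw [tendsto_zero_iff_abs_tendsto_zero]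
    have := hsq.sqrt
    simpa [Real.sqrt_sq_eq_abs, Function.comp_def] using this
  simpa using habs.add_const L

end Doubling

/-! ### Frames matched by the rotation in the plane of x and y. -/

section Frames

variable {N : ℕ}

/-- Orthonormal frames of `x^⊥` and `y^⊥` that correspond under the rotation taking `y` to `x`. -/
structure IsFramePair (x y : EuclideanSpace ℝ (Fin (N + 2)))
    (ex ey : Fin (N + 1) → EuclideanSpace ℝ (Fin (N + 2))) : Prop where
  orthonormal_left : Orthonormal ℝ ex
  orthonormal_right : Orthonormal ℝ ey
  inner_left : ∀ i, ⟪x, ex i⟫ = 0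
  inner_right : ∀ i, ⟪y, ey i⟫ = 0
  inner_left_cross : ∀ i, ⟪ex i, y⟫ = if i = 0 then -√(1 - ⟪x, y⟫ ^ 2) else 0
  inner_right_cross : ∀ i, ⟪x, ey i⟫ = if i = 0 then √(1 - ⟪x, y⟫ ^ 2) else 0
  inner_cross : ⟪ex 0, ey 0⟫ = ⟪x, y⟫
  eq_of_ne : ∀ i, i ≠ 0 → ey i = ex i

theorem orthonormal_cons {E : Type*} [NormedAddCommGroup E] [InnerProductSpace ℝ E] {e : E}
    {b : Fin N → E} (he : ‖e‖ = 1) (hb : Orthonormal ℝ b) (h : ∀ i, ⟪e, b i⟫ = 0) :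
    Orthonormal ℝ (Fin.cons e b : Fin (N + 1) → E) := by
  constructor
  · intro i
    refine Fin.cases ?_ (fun i => ?_) i
    · simpa using he
    · simpa using hb.1 i
  · intro i j hij
    induction i using Fin.cases with
    | zero =>
      induction j using Fin.cases with
      | zero => exact absurd rfl hij
      | succ j => simpa using h j
    | succ i =>
      induction j using Fin.cases with
      | zero => simpa [real_inner_comm] using h i
      | succ j => simpa using hb.2 (fun h => hij (by rw [h]))

theorem exists_isFramePair {x y : EuclideanSpace ℝ (Fin (N + 2))} (hx : ‖x‖ = 1) (hy : ‖y‖ = 1)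
    (hc : 0 < 1 - ⟪x, y⟫ ^ 2) : ∃ ex ey, IsFramePair x y ex ey := by
  set c := ⟪x, y⟫ with hcdef
  set s := √(1 - c ^ 2) with hs
  have hs0 : 0 < s := Real.sqrt_pos.2 hc
  have hs2 : s ^ 2 = 1 - c ^ 2 := Real.sq_sqrt hc.le
  have hxx : ⟪x, x⟫ = 1 := by rw [real_inner_self_eq_norm_sq, hx, one_pow]
  have hyy : ⟪y, y⟫ = 1 := by rw [real_inner_self_eq_norm_sq, hy, one_pow]
  have hyx : ⟪y, x⟫ = c := real_inner_comm x y
  -- `a` and `d` are the unit tangents at x and y of the great circle running from y to x; the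
  -- remaining frame vectors are orthogonal to that plane and shared.
  set a := s⁻¹ • (c • x - y) with ha
  set d := s⁻¹ • (x - c • y) with hd
  have hxa : ⟪x, a⟫ = 0 := by
    rw [ha, real_inner_smul_right, inner_sub_right, real_inner_smul_right, hxx]
    simp [← hcdef]
  have hyd : ⟪y, d⟫ = 0 := by
    rw [hd, real_inner_smul_right, inner_sub_right, real_inner_smul_right, hyy, hyx]
    simp
  have hay : ⟪a, y⟫ = -s := by
    rw [ha, real_inner_smul_left, inner_sub_left, real_inner_smul_left, hyy, ← hcdef]
    field_simp
    linarith
  have hxd : ⟪x, d⟫ = s := by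
    rw [hd, real_inner_smul_right, inner_sub_right, real_inner_smul_right, hxx, ← hcdef]
    field_simp
    linarith
  have had : ⟪a, d⟫ = c := by
    rw [hd, real_inner_smul_right, inner_sub_right, real_inner_smul_right, real_inner_comm, hxa, hay]
    field_simp
    ring
  have haa : ‖a‖ = 1 := by
    have : ⟪a, a⟫ = 1 := by
      conv_lhs => rw [ha, real_inner_smul_right, inner_sub_right, real_inner_smul_right, ← ha,
        real_inner_comm, hxa, hay]
      field_simp
      ring
    rw [real_inner_self_eq_norm_sq] at this
    exact (pow_eq_one_iff_of_nonneg (norm_nonneg a) two_ne_zero).1 this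
  have hdd : ‖d‖ = 1 := by
    have : ⟪d, d⟫ = 1 := by
      conv_lhs => rw [hd, real_inner_smul_left, inner_sub_left, real_inner_smul_left, ← hd,
        hyd, hxd]
      field_simp
      ring
    rw [real_inner_self_eq_norm_sq] at this
    exact (pow_eq_one_iff_of_nonneg (norm_nonneg d) two_ne_zero).1 this
  have hyeq : y = c • x - s • a := by
    rw [ha, smul_smul, mul_inv_cancel₀ hs0.ne', one_smul]; abel
  have hli : LinearIndependent ℝ ![x, a] := by
    have : Orthonormal ℝ ![x, a] := by
      rw [orthonormal_iff_ite]
      intro i j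
      fin_cases i <;> fin_cases j <;>
        simp [hxa, haa, hx, real_inner_comm]
    exact this.linearIndependent
  set V := Submodule.span ℝ (Set.range ![x, a]) with hV
  have hfr : Module.finrank ℝ Vᗮ = N := by
    have h1 := finrank_span_eq_card hli
    have h2 := V.finrank_add_finrank_orthogonal
    rw [h1, finrank_euclideanSpace_fin, Fintype.card_fin] at h2
    omega
  set b := (stdOrthonormalBasis ℝ Vᗮ).reindex (finCongr hfr) with hb
  have hbo : Orthonormal ℝ fun i => (b i : EuclideanSpace ℝ (Fin (N + 2))) :=
    b.orthonormal.comp_linearIsometry Vᗮ.subtypeₗᵢ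
  have hbx : ∀ i, ⟪x, (b i : EuclideanSpace ℝ (Fin (N + 2)))⟫ = 0 := fun i =>
    (b i).2 x (Submodule.subset_span ⟨0, rfl⟩)
  have hba : ∀ i, ⟪a, (b i : EuclideanSpace ℝ (Fin (N + 2)))⟫ = 0 := fun i =>
    (b i).2 a (Submodule.subset_span ⟨1, rfl⟩)
  have hby : ∀ i, ⟪y, (b i : EuclideanSpace ℝ (Fin (N + 2)))⟫ = 0 := fun i => by
    rw [hyeq, inner_sub_left, real_inner_smul_left, real_inner_smul_left, hbx, hba]; simp
  have hbd : ∀ i, ⟪d, (b i : EuclideanSpace ℝ (Fin (N + 2)))⟫ = 0 := fun i => by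
    rw [hd, real_inner_smul_left, inner_sub_left, real_inner_smul_left, hbx, hby]; simp
  refine ⟨Fin.cons a fun i => b i, Fin.cons d fun i => b i, orthonormal_cons haa hbo hba,
    orthonormal_cons hdd hbo hbd, ?_, ?_, ?_, ?_, ?_, ?_⟩
  · intro i
    refine Fin.cases ?_ (fun i => ?_) i
    · simpa using hxa
    · simpa using hbx i
  · intro i
    refine Fin.cases ?_ (fun i => ?_) i
    · simpa using hyd
    · simpa using hby i
  · intro i
    refine Fin.cases ?_ (fun i => ?_) i
    · simpa using hay
    · simpa [real_inner_comm] using hby i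
  · intro i
    refine Fin.cases ?_ (fun i => ?_) i
    · simpa using hxd
    · simpa using hbx i
  · simpa using had
  · intro i
    refine Fin.cases ?_ (fun i => ?_) i
    · intro h; exact absurd rfl h
    · simp

end Frames

end Sph

/-! ### The matrix of log u and its comparison at a doubled maximum. -/

namespace Sph

open Filter Topology Metric RealInnerProductSpace Matrix

section LogHess

variable {E : Type*} [NormedAddCommGroup E] [InnerProductSpace ℝ E] {m : ℕ}

/-- The matrix `f_{ij} + f_i f_j + δ_{ij}` in the frame `e`. For `f = log u` it is
`u⁻¹ (u_{ij} + u δ_{ij})`. -/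
def logHess (f : E → ℝ) (x : E) (e : Fin m → E) : Matrix (Fin m) (Fin m) ℝ :=
  Matrix.of fun i j => fderiv ℝ (fderiv ℝ f) x (e i) (e j) + fderiv ℝ f x (e i) * fderiv ℝ f x (e j) +
    if i = j then 1 else 0

theorem logHess_isHermitian {f : E → ℝ} {x : E} (hf : ContDiffAt ℝ 2 f x) (e : Fin m → E) :
    (logHess f x e).IsHermitian := by
  ext i j
  have h : IsSymmSndFDerivAt ℝ f x := hf.isSymmSndFDerivAt (by simp)
  simp only [logHess, conjTranspose_apply, of_apply, star_trivial]
  rw [h.eq (e j) (e i), mul_comm (fderiv ℝ f x (e j))]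
  simp only [eq_comm]

theorem dotProduct_logHess_mulVec (f : E → ℝ) (x : E) (e : Fin m → E) (v : Fin m → ℝ) :
    v ⬝ᵥ (logHess f x e *ᵥ v) =
      fderiv ℝ (fderiv ℝ f) x (∑ i, v i • e i) (∑ i, v i • e i) +
        (fderiv ℝ f x (∑ i, v i • e i)) ^ 2 + ∑ i, v i ^ 2 := by
  have h1 : fderiv ℝ (fderiv ℝ f) x (∑ i, v i • e i) (∑ i, v i • e i) =
      ∑ i, ∑ j, v i * (v j * fderiv ℝ (fderiv ℝ f) x (e i) (e j)) := by
    simp only [map_sum, _root_.sum_apply, map_smul, _root_.smul_apply, smul_eq_mul,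
      Finset.mul_sum]
    rw [Finset.sum_comm]
    refine Finset.sum_congr rfl fun i _ => Finset.sum_congr rfl fun j _ => by ring
  have h2 : (fderiv ℝ f x (∑ i, v i • e i)) ^ 2 =
      ∑ i, ∑ j, v i * (v j * (fderiv ℝ f x (e i) * fderiv ℝ f x (e j))) := by
    rw [map_sum, sq, Finset.sum_mul_sum]
    refine Finset.sum_congr rfl fun i _ => Finset.sum_congr rfl fun j _ => ?_
    rw [map_smul, map_smul, smul_eq_mul, smul_eq_mul]; ring
  have h3 : ∑ i, v i ^ 2 = ∑ i, ∑ j, v i * (v j * if i = j then 1 else 0) := by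
    refine Finset.sum_congr rfl fun i _ => ?_
    simp [sq]
  rw [h1, h2, h3, ← Finset.sum_add_distrib, ← Finset.sum_add_distrib]
  refine Finset.sum_congr rfl fun i _ => ?_
  rw [← Finset.sum_add_distrib, ← Finset.sum_add_distrib, mulVec, dotProduct, Finset.mul_sum]
  refine Finset.sum_congr rfl fun j _ => ?_
  rw [logHess, of_apply]; ring

theorem tendsto_clm_apply {F G : Type*} [NormedAddCommGroup F] [NormedSpace ℝ F]
    [NormedAddCommGroup G] [NormedSpace ℝ G] {ι : Type*} {l : Filter ι} {A : ι → F →L[ℝ] G}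
    {v : ι → F} {A₀ : F →L[ℝ] G} {v₀ : F} (hA : Tendsto A l (𝓝 A₀)) (hv : Tendsto v l (𝓝 v₀)) :
    Tendsto (fun j => A j (v j)) l (𝓝 (A₀ v₀)) :=
  ((isBoundedBilinearMap_apply (𝕜 := ℝ) (E := F) (F := G)).continuous.tendsto (A₀, v₀)).comp
    (hA.prodMk_nhds hv)

theorem tendsto_logHess {f : E → ℝ} (hf : ∀ y, y ≠ 0 → ContDiffAt ℝ 2 f y) {ι : Type*}
    {l : Filter ι} {x : ι → E} {e : ι → Fin m → E} {x₀ : E} {e₀ : Fin m → E} (hx₀ : x₀ ≠ 0)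
    (hx : Tendsto x l (𝓝 x₀)) (he : ∀ i, Tendsto (fun j => e j i) l (𝓝 (e₀ i))) :
    Tendsto (fun j => logHess f (x j) (e j)) l (𝓝 (logHess f x₀ e₀)) := by
  have h1 : ContDiffAt ℝ 1 (fderiv ℝ f) x₀ := (hf x₀ hx₀).fderiv_right (by norm_num)
  have h2 : ContinuousAt (fderiv ℝ (fderiv ℝ f)) x₀ :=
    (h1.fderiv_right (m := 0) (by norm_num)).continuousAt
  have h3 : Tendsto (fun j => fderiv ℝ (fderiv ℝ f) (x j)) l (𝓝 (fderiv ℝ (fderiv ℝ f) x₀)) :=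
    h2.tendsto.comp hx
  have h4 : Tendsto (fun j => fderiv ℝ f (x j)) l (𝓝 (fderiv ℝ f x₀)) :=
    h1.continuousAt.tendsto.comp hx
  refine tendsto_pi_nhds.2 fun a => tendsto_pi_nhds.2 fun b => ?_
  exact ((tendsto_clm_apply (tendsto_clm_apply h3 (he a)) (he b)).add
    ((tendsto_clm_apply h4 (he a)).mul (tendsto_clm_apply h4 (he b)))).add_const _

end LogHess

section Comparison

variable {E : Type*} [NormedAddCommGroup E] [InnerProductSpace ℝ E]

/-- Moving one point at a time identifies each gradient with κ times a tangential projection of the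
other point, and both projections have length sin ∠(x, y). This makes the gradient factors of the
equation cancel between x and y. -/
theorem norm_fderiv_of_isDoubledMax {f : E → ℝ} (hf : ∀ y, y ≠ 0 → ContDiffAt ℝ 2 f y)
    (hom : ∀ t : ℝ, 0 < t → ∀ y, f (t • y) = f y) {κ : ℝ}
    (hκ : 0 ≤ κ) {x y : E} (hx : ‖x‖ = 1) (hy : ‖y‖ = 1) (hmax : IsDoubledMax f κ x y)
    (hc : 0 < ⟪x, y⟫) :
    ‖fderiv ℝ f x‖ = κ * √(1 - ⟪x, y⟫ ^ 2) ∧ ‖fderiv ℝ f y‖ = κ * √(1 - ⟪x, y⟫ ^ 2) := by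
  have hx0 : x ≠ 0 := norm_ne_zero_iff.1 (by rw [hx]; simp)
  have hy0 : y ≠ 0 := norm_ne_zero_iff.1 (by rw [hy]; simp)
  have hxx : ⟪x, x⟫ = 1 := by rw [real_inner_self_eq_norm_sq, hx, one_pow]
  have hyy : ⟪y, y⟫ = 1 := by rw [real_inner_self_eq_norm_sq, hy, one_pow]
  set c := ⟪x, y⟫ with hcdef
  have hyx : ⟪y, x⟫ = c := real_inner_comm x y
  have hn : ∀ a b : E, ‖a‖ = 1 → ‖b‖ = 1 → ⟪a, b⟫ = c → ‖b - c • a‖ = √(1 - c ^ 2) := by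
    intro a b ha hb hab
    rw [← Real.sqrt_sq (norm_nonneg (b - c • a))]
    congr 1
    rw [norm_sub_sq_real, real_inner_smul_right, real_inner_comm, hab, norm_smul, ha, hb,
      Real.norm_eq_abs, mul_one, sq_abs]
    ring
  constructor
  · have h : fderiv ℝ f x = (-κ) • innerSL ℝ (y - c • x) := by
      ext v
      have h1 := (variation_of_doubled_max hf hκ hx hy hmax hc (ξ := v - ⟪x, v⟫ • x) (η := 0)
        (by rw [inner_sub_right, real_inner_smul_right, hxx]; ring) (by simp)).1
      rw [map_sub, map_smul, fderiv_self_of_homogeneous hom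
        ((hf x hx0).differentiableAt two_ne_zero)] at h1
      simp only [smul_zero, sub_zero, map_zero, inner_zero_right, zero_add, inner_sub_left,
        real_inner_smul_left] at h1
      simp only [_root_.smul_apply, innerSL_apply_apply, inner_sub_left,
        real_inner_smul_left, smul_eq_mul]
      rw [real_inner_comm y v] at h1
      linarith
    rw [h, norm_smul, innerSL_apply_norm, hn x y hx hy rfl, norm_neg, Real.norm_of_nonneg hκ]
  · have h : fderiv ℝ f y = κ • innerSL ℝ (x - c • y) := by
      ext v
      have h1 := (variation_of_doubled_max hf hκ hx hy hmax hc (η := v - ⟪y, v⟫ • y) (ξ := 0)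
        (by simp) (by rw [inner_sub_right, real_inner_smul_right, hyy]; ring)).1
      rw [map_sub, map_smul, fderiv_self_of_homogeneous hom
        ((hf y hy0).differentiableAt two_ne_zero)] at h1
      simp only [smul_zero, sub_zero, map_zero, inner_zero_left, add_zero, inner_sub_right,
        real_inner_smul_right] at h1
      simp only [_root_.smul_apply, innerSL_apply_apply, inner_sub_left,
        real_inner_smul_left, smul_eq_mul]
      linarith
    rw [h, norm_smul, innerSL_apply_norm, hn y x hy hx hyx, Real.norm_of_nonneg hκ]

variable {N : ℕ}

theorem fderiv_frame_of_isDoubledMax {f : EuclideanSpace ℝ (Fin (N + 2)) → ℝ}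
    (hf : ∀ y, y ≠ 0 → ContDiffAt ℝ 2 f y) {κ : ℝ}
    (hκ : 0 ≤ κ) {x y : EuclideanSpace ℝ (Fin (N + 2))} (hx : ‖x‖ = 1) (hy : ‖y‖ = 1)
    (hmax : IsDoubledMax f κ x y) (hc : 0 < ⟪x, y⟫)
    {ex ey : Fin (N + 1) → EuclideanSpace ℝ (Fin (N + 2))} (he : IsFramePair x y ex ey)
    (i : Fin (N + 1)) :
    fderiv ℝ f x (ex i) = (if i = 0 then κ * √(1 - ⟪x, y⟫ ^ 2) else 0) ∧
    fderiv ℝ f y (ey i) = (if i = 0 then κ * √(1 - ⟪x, y⟫ ^ 2) else 0) := by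
  have h1 := (variation_of_doubled_max hf hκ hx hy hmax hc (he.inner_left i) (inner_zero_right y)).1
  have h2 := (variation_of_doubled_max hf hκ hx hy hmax hc (inner_zero_right x) (he.inner_right i)).1
  rw [he.inner_left_cross] at h1
  rw [he.inner_right_cross] at h2
  simp only [map_zero, inner_zero_right, inner_zero_left] at h1 h2
  constructor
  · split_ifs with h <;> simp only [h, if_true, if_false] at h1 ⊢ <;> linarith
  · split_ifs with h <;> simp only [h, if_true, if_false] at h2 ⊢ <;> linarith

theorem norm_sq_sum_smul {e : Fin N → E} (he : Orthonormal ℝ e) (v : Fin N → ℝ) :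
    ‖∑ i, v i • e i‖ ^ 2 = ∑ i, v i ^ 2 := by
  rw [← real_inner_self_eq_norm_sq, he.inner_sum]
  simp [sq]

theorem IsFramePair.inner_sum {x y : EuclideanSpace ℝ (Fin (N + 2))}
    {ex ey : Fin (N + 1) → EuclideanSpace ℝ (Fin (N + 2))} (he : IsFramePair x y ex ey)
    (v : Fin (N + 1) → ℝ) :
    ⟪∑ i, v i • ex i, ∑ i, v i • ey i⟫ = ⟪x, y⟫ * v 0 ^ 2 + ∑ i : Fin N, v i.succ ^ 2 := by
  have h : ∀ i j, ⟪ex i, ey j⟫ = if i = j then (if i = 0 then ⟪x, y⟫ else 1) else 0 := by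
    intro i j
    rcases eq_or_ne j 0 with rfl | hj
    · rcases eq_or_ne i 0 with rfl | hi
      · simpa using he.inner_cross
      · rw [if_neg hi, ← he.eq_of_ne i hi]
        exact he.orthonormal_right.2 hi
    · rw [he.eq_of_ne j hj]
      rcases eq_or_ne i j with rfl | hij
      · rw [if_pos rfl, if_neg hj, real_inner_self_eq_norm_sq, he.orthonormal_left.1, one_pow]
      · rw [if_neg hij]; exact he.orthonormal_left.2 hij
  simp only [sum_inner, _root_.inner_sum, real_inner_smul_left, real_inner_smul_right, h]
  rw [Fin.sum_univ_succ]
  simp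
  rw [← Finset.sum_congr rfl fun i _ => sq (v (Fin.succ i))]
  ring

/-- Second order comparison of the two matrices at a doubled maximum. -/
theorem posSemidef_of_isDoubledMax {f : EuclideanSpace ℝ (Fin (N + 2)) → ℝ}
    (hf : ∀ y, y ≠ 0 → ContDiffAt ℝ 2 f y) {κ : ℝ}
    (hκ : 0 ≤ κ) {x y : EuclideanSpace ℝ (Fin (N + 2))} (hx : ‖x‖ = 1) (hy : ‖y‖ = 1)
    (hmax : IsDoubledMax f κ x y) (hc : 0 < ⟪x, y⟫)
    {ex ey : Fin (N + 1) → EuclideanSpace ℝ (Fin (N + 2))} (he : IsFramePair x y ex ey) :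
    (logHess f y ey - (logHess f x ex + (κ * ‖x - y‖ ^ 2) • tailProj N)).PosSemidef := by
  have hx0 : x ≠ 0 := norm_ne_zero_iff.1 (by rw [hx]; simp)
  have hy0 : y ≠ 0 := norm_ne_zero_iff.1 (by rw [hy]; simp)
  refine PosSemidef.of_dotProduct_mulVec_nonneg ?_ fun v => ?_
  · refine (logHess_isHermitian (hf y hy0) ey).sub ((logHess_isHermitian (hf x hx0) ex).add ?_)
    rw [tailProj, ← diagonal_smul]
    exact isHermitian_diagonal _
  · rw [star_trivial, sub_mulVec, add_mulVec, dotProduct_sub, dotProduct_add,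
      dotProduct_logHess_mulVec, dotProduct_logHess_mulVec]
    set ξ := ∑ i, v i • ex i with hξ
    set η := ∑ i, v i • ey i with hη
    have hP : v ⬝ᵥ (((κ * ‖x - y‖ ^ 2) • tailProj N) *ᵥ v) =
        κ * ‖x - y‖ ^ 2 * ∑ i : Fin N, v i.succ ^ 2 := by
      rw [smul_mulVec, dotProduct_smul, smul_eq_mul, tailProj, dotProduct]
      simp only [mulVec_diagonal]
      rw [Fin.sum_univ_succ]
      simp [sq]
    have hDξ : fderiv ℝ f x ξ = v 0 * (κ * √(1 - ⟪x, y⟫ ^ 2)) := by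
      rw [hξ, map_sum]
      simp [(fderiv_frame_of_isDoubledMax hf hκ hx hy hmax hc he _).1]
    have hDη : fderiv ℝ f y η = v 0 * (κ * √(1 - ⟪x, y⟫ ^ 2)) := by
      rw [hη, map_sum]
      simp [(fderiv_frame_of_isDoubledMax hf hκ hx hy hmax hc he _).2]
    have h2 := (variation_of_doubled_max hf hκ hx hy hmax hc (ξ := ξ) (η := η)
      (by rw [hξ, _root_.inner_sum]; simp [real_inner_smul_right, he.inner_left])
      (by rw [hη, _root_.inner_sum]; simp [real_inner_smul_right, he.inner_right])).2
    rw [he.inner_sum, norm_sq_sum_smul he.orthonormal_left, norm_sq_sum_smul he.orthonormal_right,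
      Fin.sum_univ_succ] at h2
    -- The squared first derivatives agree and cancel. What remains is 2⟨ξ,η⟩ - ⟨x,y⟩(|ξ|²+|η|²) =
    -- |x-y|² Σ_{i≥1} v_i², with no gain in the gradient direction.
    rw [hP, hDξ, hDη]
    rw [inner_eq_of_norm_eq_one hx hy] at h2 ⊢
    linarith

/-- Second order comparison for variations of different speeds. -/
theorem snd_variation_scaled {f : EuclideanSpace ℝ (Fin (N + 2)) → ℝ}
    (hf : ∀ y, y ≠ 0 → ContDiffAt ℝ 2 f y) {κ : ℝ}
    (hκ : 0 ≤ κ) {x y : EuclideanSpace ℝ (Fin (N + 2))} (hx : ‖x‖ = 1) (hy : ‖y‖ = 1)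
    (hmax : IsDoubledMax f κ x y) (hc : 0 < ⟪x, y⟫)
    {ex ey : Fin (N + 1) → EuclideanSpace ℝ (Fin (N + 2))} (he : IsFramePair x y ex ey)
    (σ : ℝ) {i : Fin (N + 1)} (hi : i ≠ 0) :
    (1 + σ) ^ 2 * fderiv ℝ (fderiv ℝ f) x (ex i) (ex i) -
      (1 - σ) ^ 2 * fderiv ℝ (fderiv ℝ f) y (ey i) (ey i) ≤ κ * (4 * σ ^ 2 - ‖x - y‖ ^ 2) := by
  have h2 := (variation_of_doubled_max hf hκ hx hy hmax hc
    (ξ := (1 + σ) • ex i) (η := (1 - σ) • ey i)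
    (by rw [real_inner_smul_right, he.inner_left, mul_zero])
    (by rw [real_inner_smul_right, he.inner_right, mul_zero])).2
  rw [norm_smul, norm_smul, he.orthonormal_left.1, he.orthonormal_right.1, real_inner_smul_left,
    real_inner_smul_right, he.eq_of_ne i hi, real_inner_self_eq_norm_sq, he.orthonormal_left.1,
    inner_eq_of_norm_eq_one hx hy] at h2
  simp only [map_smul, _root_.smul_apply, smul_eq_mul, mul_one, Real.norm_eq_abs,
    sq_abs] at h2
  rw [he.eq_of_ne i hi]
  have : 0 ≤ κ * (σ ^ 2 * ‖x - y‖ ^ 2) := by positivity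
  nlinarith

end Comparison

/-! ### Passing to a limit point of maximal gradient. -/

section Limit

variable {N : ℕ}

theorem exists_frame_sequence {f : EuclideanSpace ℝ (Fin (N + 2)) → ℝ}
    (hf : ∀ y, y ≠ 0 → ContDiffAt ℝ 2 f y) (hom : ∀ t : ℝ, 0 < t → ∀ y, f (t • y) = f y)
    {L : ℝ} (hL : 0 < L) (hG : ∀ x, ‖x‖ = 1 → ‖fderiv ℝ f x‖ ≤ L)
    {z : EuclideanSpace ℝ (Fin (N + 2))} (hz : ‖z‖ = 1) (hzL : ‖fderiv ℝ f z‖ = L) :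
    ∃ (κ : ℕ → ℝ) (x y : ℕ → EuclideanSpace ℝ (Fin (N + 2)))
      (ex ey : ℕ → Fin (N + 1) → EuclideanSpace ℝ (Fin (N + 2)))
      (x₀ : EuclideanSpace ℝ (Fin (N + 2))) (e₀ : Fin (N + 1) → EuclideanSpace ℝ (Fin (N + 2))),
      (∀ j, 0 < κ j) ∧ (∀ j, ‖x j‖ = 1) ∧ (∀ j, ‖y j‖ = 1) ∧
      (∀ j, IsDoubledMax f (κ j) (x j) (y j)) ∧ (∀ j, 0 < ⟪x j, y j⟫) ∧ (∀ j, 0 < ‖x j - y j‖) ∧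
      (∀ j, IsFramePair (x j) (y j) (ex j) (ey j)) ∧
      Tendsto (fun j => ‖x j - y j‖) atTop (𝓝 0) ∧
      Tendsto (fun j => κ j * ‖x j - y j‖) atTop (𝓝 L) ∧
      Tendsto x atTop (𝓝 x₀) ∧ Tendsto y atTop (𝓝 x₀) ∧
      ∀ i, Tendsto (fun j => ex j i) atTop (𝓝 (e₀ i)) := by
  obtain ⟨κ, x, y, hκ, hx, hy, hmax, hr, hq⟩ := exists_doubled_max_sequence hom
    (fun y hy => (hf y hy).differentiableAt two_ne_zero) hL hG hz hzL
  have hev : ∀ᶠ j in atTop, 0 < ⟪x j, y j⟫ ∧ 0 < ‖x j - y j‖ := by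
    filter_upwards [hr.eventually (gt_mem_nhds one_pos), hq.eventually (lt_mem_nhds hL)] with j h1 h2
    have h3 : 0 < ‖x j - y j‖ := pos_of_mul_pos_right h2 (hκ j).le
    refine ⟨?_, h3⟩
    rw [inner_eq_of_norm_eq_one (hx j) (hy j)]
    nlinarith
  -- Early indices are discarded so that x ≠ y and the angle is acute for every j, as frames and
  -- variations require.
  obtain ⟨j₀, hj₀⟩ := eventually_atTop.1 hev
  have hfr : ∀ j, ∃ ex ey, IsFramePair (x (j + j₀)) (y (j + j₀)) ex ey := fun j => by
    obtain ⟨h1, h2⟩ := hj₀ (j + j₀) (by omega)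
    refine exists_isFramePair (hx _) (hy _) ?_
    have h3 := inner_eq_of_norm_eq_one (hx (j + j₀)) (hy (j + j₀))
    nlinarith [sq_pos_of_pos h2]
  choose ex ey hfr using hfr
  have hK : IsCompact ((sphere (0 : EuclideanSpace ℝ (Fin (N + 2))) 1) ×ˢ
      (Set.univ.pi fun _ : Fin (N + 1) => sphere (0 : EuclideanSpace ℝ (Fin (N + 2))) 1)) :=
    (isCompact_sphere _ _).prod (isCompact_univ_pi fun _ => isCompact_sphere _ _)
  obtain ⟨⟨x₀, e₀⟩, -, ψ, hψ, hlim⟩ := hK.tendsto_subseq (x := fun j => (x (j + j₀), ex j))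
    fun j => ⟨mem_sphere_zero_iff_norm.2 (hx _),
      fun i _ => mem_sphere_zero_iff_norm.2 ((hfr j).orthonormal_left.1 i)⟩
  have hθ : Tendsto (fun j => ψ j + j₀) atTop atTop :=
    (tendsto_add_atTop_nat j₀).comp hψ.tendsto_atTop
  have hxl : Tendsto (fun j => x (ψ j + j₀)) atTop (𝓝 x₀) :=
    (continuous_fst.tendsto _).comp hlim
  have hel : Tendsto (fun j => ex (ψ j)) atTop (𝓝 e₀) := (continuous_snd.tendsto _).comp hlim
  refine ⟨fun j => κ (ψ j + j₀), fun j => x (ψ j + j₀), fun j => y (ψ j + j₀),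
    fun j => ex (ψ j), fun j => ey (ψ j), x₀, e₀, fun j => hκ _, fun j => hx _, fun j => hy _,
    fun j => hmax _, fun j => (hj₀ _ (by omega)).1, fun j => (hj₀ _ (by omega)).2,
    fun j => hfr _, hr.comp hθ, hq.comp hθ, hxl, ?_, fun i => tendsto_pi_nhds.1 hel i⟩
  have h0 : Tendsto (fun j => x (ψ j + j₀) - y (ψ j + j₀)) atTop (𝓝 0) :=
    tendsto_zero_iff_norm_tendsto_zero.2 (hr.comp hθ)
  simpa using hxl.sub h0

/-- The full gradient and one row of the Hessian at a point of maximal gradient. -/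
theorem snd_fderiv_eq_zero_of_max {E : Type*} [NormedAddCommGroup E] [InnerProductSpace ℝ E]
    {f : E → ℝ} (hf : ∀ y, y ≠ 0 → ContDiffAt ℝ 2 f y)
    (hom : ∀ t : ℝ, 0 < t → ∀ y, f (t • y) = f y)
    {L : ℝ} (hL : 0 ≤ L) (hG : ∀ x : E, ‖x‖ = 1 → ‖fderiv ℝ f x‖ ≤ L) {x e ξ : E} (hx : ‖x‖ = 1)
    (he : ‖e‖ = 1) (hxe : fderiv ℝ f x e = L) (hξ : ⟪x, ξ⟫ = 0) :
    fderiv ℝ (fderiv ℝ f) x ξ e = 0 := by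
  have hx0 : x ≠ 0 := norm_ne_zero_iff.1 (by rw [hx]; simp)
  have h := (hasDerivAt_along_line hf hx0 ξ).2 e
  -- Off the sphere the gradient bound only improves: it is L/|x + tξ|, and |x + tξ| ≥ 1 because ξ
  -- is tangent.
  have hmax : IsLocalMax (fun t : ℝ => fderiv ℝ f (x + t • ξ) e) 0 := by
    refine Eventually.of_forall fun t => ?_
    simp only [zero_smul, add_zero, hxe]
    have hnx : ‖x + t • ξ‖ ^ 2 = 1 + t ^ 2 * ‖ξ‖ ^ 2 := by
      rw [norm_add_sq_real, real_inner_smul_right, hξ, hx, norm_smul, mul_pow, Real.norm_eq_abs,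
        sq_abs]; ring
    have hA : 1 ≤ ‖x + t • ξ‖ := by
      have : 0 ≤ t ^ 2 * ‖ξ‖ ^ 2 := by positivity
      exact (sq_le_sq₀ zero_le_one (norm_nonneg _)).1 (by rw [hnx, one_pow]; linarith)
    have hne : x + t • ξ ≠ 0 := norm_pos_iff.1 (by linarith)
    calc fderiv ℝ f (x + t • ξ) e ≤ ‖fderiv ℝ f (x + t • ξ)‖ * ‖e‖ :=
          (le_abs_self _).trans ((fderiv ℝ f (x + t • ξ)).le_opNorm e)
      _ ≤ L / ‖x + t • ξ‖ * 1 := by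
          rw [he]; gcongr; exact norm_fderiv_le_div_norm hom hG hne
      _ ≤ L := by rw [mul_one]; exact div_le_self hL hA
  rw [← h.deriv]
  exact hmax.deriv_eq_zero

end Limit

end Sph

namespace Sph

open Filter Topology Metric RealInnerProductSpace Matrix

variable {N : ℕ}

/-- At the limit the gradient is L in the direction `e₀ 0` and has maximal length. Hence the Hessian
row of that direction vanishes and the matrix splits off the entry 1 + L². -/
theorem exists_frame_sequence_with_limit {f : EuclideanSpace ℝ (Fin (N + 2)) → ℝ}
    (hf : ∀ y, y ≠ 0 → ContDiffAt ℝ 2 f y) (hom : ∀ t : ℝ, 0 < t → ∀ y, f (t • y) = f y)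
    {L : ℝ} (hL : 0 < L) (hG : ∀ x, ‖x‖ = 1 → ‖fderiv ℝ f x‖ ≤ L)
    {z : EuclideanSpace ℝ (Fin (N + 2))} (hz : ‖z‖ = 1) (hzL : ‖fderiv ℝ f z‖ = L) :
    ∃ (κ : ℕ → ℝ) (x y : ℕ → EuclideanSpace ℝ (Fin (N + 2)))
      (ex ey : ℕ → Fin (N + 1) → EuclideanSpace ℝ (Fin (N + 2)))
      (x₀ : EuclideanSpace ℝ (Fin (N + 2))) (e₀ : Fin (N + 1) → EuclideanSpace ℝ (Fin (N + 2))),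
      ((∀ j, 0 < κ j) ∧ (∀ j, ‖x j‖ = 1) ∧ (∀ j, ‖y j‖ = 1) ∧
      (∀ j, IsDoubledMax f (κ j) (x j) (y j)) ∧ (∀ j, 0 < ⟪x j, y j⟫) ∧ (∀ j, 0 < ‖x j - y j‖) ∧
      (∀ j, IsFramePair (x j) (y j) (ex j) (ey j)) ∧
      Tendsto (fun j => ‖x j - y j‖) atTop (𝓝 0) ∧
      Tendsto (fun j => κ j * ‖x j - y j‖) atTop (𝓝 L) ∧
      Tendsto x atTop (𝓝 x₀) ∧ Tendsto y atTop (𝓝 x₀) ∧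
      ∀ i, Tendsto (fun j => ex j i) atTop (𝓝 (e₀ i))) ∧
      ‖x₀‖ = 1 ∧ Orthonormal ℝ e₀ ∧ (∀ i, ⟪x₀, e₀ i⟫ = 0) ∧ ‖fderiv ℝ f x₀‖ = L ∧
      fderiv ℝ (fderiv ℝ f) x₀ (e₀ 0) (e₀ 0) = 0 ∧
      ∀ j, logHess f x₀ e₀ 0 j = if j = 0 then 1 + L ^ 2 else 0 := by
  obtain ⟨κ, x, y, ex, ey, x₀, e₀, hseq⟩ := exists_frame_sequence hf hom hL hG hz hzL
  refine ⟨κ, x, y, ex, ey, x₀, e₀, hseq, ?_⟩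
  obtain ⟨hκ, hx, hy, hmax, hc, hr, hfr, hrl, hql, hxl, hyl, hel⟩ := hseq
  have hx₀ : ‖x₀‖ = 1 := by
    have := hxl.norm
    simp only [hx] at this
    exact tendsto_nhds_unique this tendsto_const_nhds
  have hx₀0 : x₀ ≠ 0 := norm_ne_zero_iff.1 (by rw [hx₀]; simp)
  have hon : Orthonormal ℝ e₀ := by
    rw [orthonormal_iff_ite]
    intro i k
    have h1 := (hel i).inner (hel k) (𝕜 := ℝ)
    have h2 : ∀ j, ⟪ex j i, ex j k⟫ = if i = k then (1 : ℝ) else 0 := fun j =>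
      orthonormal_iff_ite.1 (hfr j).orthonormal_left i k
    simp only [h2] at h1
    exact (tendsto_nhds_unique h1 tendsto_const_nhds)
  have hperp : ∀ i, ⟪x₀, e₀ i⟫ = 0 := fun i => by
    have h1 := hxl.inner (hel i) (𝕜 := ℝ)
    simp only [fun j => (hfr j).inner_left i] at h1
    exact (tendsto_nhds_unique h1 tendsto_const_nhds)
  have hs : Tendsto (fun j => κ j * √(1 - ⟪x j, y j⟫ ^ 2)) atTop (𝓝 L) := by
    have h1 : ∀ j, κ j * √(1 - ⟪x j, y j⟫ ^ 2) =
        κ j * ‖x j - y j‖ * √(1 - ‖x j - y j‖ ^ 2 / 4) := by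
      intro j
      have h2 : 1 - ⟪x j, y j⟫ ^ 2 = ‖x j - y j‖ ^ 2 * (1 - ‖x j - y j‖ ^ 2 / 4) := by
        rw [inner_eq_of_norm_eq_one (hx j) (hy j)]; ring
      rw [h2, Real.sqrt_mul (sq_nonneg _), Real.sqrt_sq (hr j).le, mul_assoc]
    simp only [h1]
    have h3 := hql.mul ((((hrl.pow 2).div_const 4).const_sub 1).sqrt)
    simpa using h3
  have hDc : Tendsto (fun j => fderiv ℝ f (x j)) atTop (𝓝 (fderiv ℝ f x₀)) :=
    (((hf x₀ hx₀0).fderiv_right (m := 1) (by norm_num)).continuousAt.tendsto).comp hxl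
  have hD : ∀ i, fderiv ℝ f x₀ (e₀ i) = if i = 0 then L else 0 := fun i => by
    have h1 := tendsto_clm_apply hDc (hel i)
    simp only [fun j => (fderiv_frame_of_isDoubledMax hf (hκ j).le (hx j) (hy j) (hmax j) (hc j)
      (hfr j) i).1] at h1
    refine tendsto_nhds_unique h1 ?_
    split_ifs
    · exact hs
    · exact tendsto_const_nhds
  have hDn : ‖fderiv ℝ f x₀‖ = L := by
    have h1 := hDc.norm
    simp only [fun j => (norm_fderiv_of_isDoubledMax hf hom (hκ j).le (hx j) (hy j) (hmax j)
      (hc j)).1] at h1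
    exact tendsto_nhds_unique h1 hs
  have hD2 : ∀ i, fderiv ℝ (fderiv ℝ f) x₀ (e₀ i) (e₀ 0) = 0 := fun i =>
    snd_fderiv_eq_zero_of_max hf hom hL.le hG hx₀ (hon.1 0) (by simpa using hD 0) (hperp i)
  refine ⟨hx₀, hon, hperp, hDn, hD2 0, fun i => ?_⟩
  have hsymm : IsSymmSndFDerivAt ℝ f x₀ := (hf x₀ hx₀0).isSymmSndFDerivAt (by simp)
  rw [logHess, of_apply, hsymm.eq, hD2, hD, hD, if_pos rfl]
  rcases eq_or_ne i 0 with rfl | hi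
  · simp; ring
  · simp [hi, hi.symm]

theorem exists_orthonormal_frame {x : EuclideanSpace ℝ (Fin (N + 1))} (hx : ‖x‖ = 1) :
    ∃ e : Fin N → EuclideanSpace ℝ (Fin (N + 1)), Orthonormal ℝ e ∧ ∀ i, ⟪x, e i⟫ = 0 := by
  have hx0 : x ≠ 0 := norm_ne_zero_iff.1 (by rw [hx]; simp)
  have : Fact (Module.finrank ℝ (EuclideanSpace ℝ (Fin (N + 1))) = N + 1) :=
    ⟨finrank_euclideanSpace_fin⟩
  have b := OrthonormalBasis.fromOrthogonalSpanSingleton (𝕜 := ℝ) N hx0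
  exact ⟨fun i => b i, b.orthonormal.comp_linearIsometry (Submodule.subtypeₗᵢ _),
    fun i => (b i).2 x (Submodule.mem_span_singleton_self x)⟩

/-! ### The equation for log u and the gradient estimate. -/

/-- The right hand side of the equation satisfied by `f = log u`. -/
def rhs (ε q : ℝ) (f φ : EuclideanSpace ℝ (Fin (N + 1)) → ℝ)
    (x : EuclideanSpace ℝ (Fin (N + 1))) : ℝ :=
  Real.exp (ε * f x) * (1 + ‖fderiv ℝ f x‖ ^ 2) ^ q * φ x

/-- The equation `σ_k(f_{ij} + f_i f_j + δ_{ij}) = e^{ε f} (1 + |∇f|²)^q φ` on the unit sphere, for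
functions that are homogeneous of degree zero, with the bounds on `φ`. -/
structure IsLogSolution (k : ℕ) (ε q m K : ℝ) (f φ : EuclideanSpace ℝ (Fin (N + 1)) → ℝ) :
    Prop where
  hε : 0 ≤ ε
  hq : q ≤ (k : ℝ) / 2
  hm : 0 < m
  contDiffAt : ∀ y, y ≠ 0 → ContDiffAt ℝ 2 f y
  hom : ∀ t : ℝ, 0 < t → ∀ y, f (t • y) = f y
  differentiableAt : ∀ y, y ≠ 0 → DifferentiableAt ℝ φ y
  hom_rhs : ∀ t : ℝ, 0 < t → ∀ y, φ (t • y) = φ y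
  le_rhs : ∀ x, ‖x‖ = 1 → m ≤ φ x
  rhs_le : ∀ x, ‖x‖ = 1 → φ x ≤ K
  fderiv_rhs_le : ∀ x, ‖x‖ = 1 → ‖fderiv ℝ φ x‖ ≤ K
  admissible : ∀ x, ‖x‖ = 1 → ∀ e : Fin N → EuclideanSpace ℝ (Fin (N + 1)), Orthonormal ℝ e →
    (∀ i, ⟪x, e i⟫ = 0) → InGamma k (logHess f x e)
  equation : ∀ x, ‖x‖ = 1 → ∀ e : Fin N → EuclideanSpace ℝ (Fin (N + 1)), Orthonormal ℝ e →
    (∀ i, ⟪x, e i⟫ = 0) → sigma k (logHess f x e) = rhs ε q f φ x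

theorem ne_zero_of_norm_eq_one {E : Type*} [NormedAddCommGroup E] {x : E} (hx : ‖x‖ = 1) :
    x ≠ 0 := norm_ne_zero_iff.1 (by rw [hx]; simp)

namespace IsLogSolution

variable {k : ℕ} {ε q m K : ℝ}

theorem K_pos {f φ : EuclideanSpace ℝ (Fin (N + 1)) → ℝ} (h : IsLogSolution k ε q m K f φ) :
    0 < K := by
  obtain ⟨x, hx⟩ := exists_norm_eq (EuclideanSpace ℝ (Fin (N + 1))) zero_le_one
  exact h.hm.trans_le ((h.le_rhs x hx).trans (h.rhs_le x hx))

theorem exp_le {f φ : EuclideanSpace ℝ (Fin (N + 1)) → ℝ} (h : IsLogSolution k ε q m K f φ)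
    (hk : 1 ≤ k) (hkn : k ≤ N) {x : EuclideanSpace ℝ (Fin (N + 1))} (hx : ‖x‖ = 1) :
    Real.exp (ε * f x) ≤ sigma k (1 : Matrix (Fin N) (Fin N) ℝ) / m := by
  obtain ⟨z, hz, hzmax⟩ := (isCompact_sphere (0 : EuclideanSpace ℝ (Fin (N + 1))) 1).exists_isMaxOn
    (NormedSpace.sphere_nonempty.2 zero_le_one) (f := f) fun y hy =>
      (h.contDiffAt y (ne_zero_of_norm_eq_one
        (mem_sphere_zero_iff_norm.1 hy))).continuousAt.continuousWithinAt
  have hz1 := mem_sphere_zero_iff_norm.1 hz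
  have hz0 := ne_zero_of_norm_eq_one hz1
  have hall : ∀ y, y ≠ 0 → f y ≤ f z := by
    intro y hy
    have hy' := norm_pos_iff.2 hy
    rw [← h.hom _ (inv_pos.2 hy') y]
    exact hzmax (mem_sphere_zero_iff_norm.2 (by
      rw [norm_smul, norm_inv, norm_norm, inv_mul_cancel₀ hy'.ne']))
  have hlm : IsLocalMax f z := by
    filter_upwards [isOpen_ne.mem_nhds hz0] with y hy using hall y hy
  have hD0 : fderiv ℝ f z = 0 := hlm.fderiv_eq_zero
  obtain ⟨e, he, hze⟩ := exists_orthonormal_frame hz1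
  have hW := logHess_isHermitian (h.contDiffAt z hz0) e
  -- At a maximum of f the gradient vanishes and the Hessian is nonpositive; monotonicity of σ_k
  -- then bounds e^{εf}φ by σ_k(I).
  have hpsd : (1 - logHess f z e).PosSemidef := by
    refine PosSemidef.of_dotProduct_mulVec_nonneg (isHermitian_one.sub hW) fun v => ?_
    rw [star_trivial, sub_mulVec, dotProduct_sub, dotProduct_logHess_mulVec, hD0, one_mulVec]
    set ξ := ∑ i, v i • e i
    obtain ⟨h1, h2⟩ := hasDerivAt_along_line h.contDiffAt hz0 ξ
    have hlm' : IsLocalMax (fun t : ℝ => f (z + t • ξ)) 0 := by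
      have hc : ContinuousAt (fun t : ℝ => z + t • ξ) 0 := by fun_prop
      have := hc.eventually_ne (y := 0) (by simpa using hz0)
      filter_upwards [this] with t ht
      simpa using hall _ ht
    have h3 := (second_derivative_test hlm' h1 (h2 ξ)).2
    have h4 : v ⬝ᵥ v = ∑ i, v i ^ 2 := by simp [dotProduct, sq]
    rw [h4]
    simp
    linarith
  have hmono := (h.admissible z hz1 e he hze).add_posSemidef hkn hW hpsd
  have h5 := hmono.2 k hk le_rfl
  rw [add_sub_cancel, h.equation z hz1 e he hze, rhs, hD0] at h5
  simp only [norm_zero, ne_eq, OfNat.ofNat_ne_zero, not_false_eq_true, zero_pow, add_zero,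
    Real.one_rpow, mul_one] at h5
  have h6 : Real.exp (ε * f x) ≤ Real.exp (ε * f z) := by
    gcongr
    · exact h.hε
    · exact hall x (ne_zero_of_norm_eq_one hx)
  refine h6.trans ?_
  rw [le_div_iff₀ h.hm]
  exact (mul_le_mul_of_nonneg_left (h.le_rhs z hz1) (Real.exp_pos _).le).trans h5

theorem rhs_pos {f φ : EuclideanSpace ℝ (Fin (N + 1)) → ℝ} (h : IsLogSolution k ε q m K f φ)
    {x : EuclideanSpace ℝ (Fin (N + 1))} (hx : ‖x‖ = 1) : 0 < rhs ε q f φ x :=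
  mul_pos (mul_pos (Real.exp_pos _) (Real.rpow_pos_of_pos (by positivity) _))
    (h.hm.trans_le (h.le_rhs x hx))

/-- The growth is at most that of R^k because q ≤ k/2; this is where p > 1 enters. -/
theorem rhs_le_pow {f φ : EuclideanSpace ℝ (Fin (N + 1)) → ℝ} (h : IsLogSolution k ε q m K f φ)
    (hk : 1 ≤ k) (hkn : k ≤ N) {x : EuclideanSpace ℝ (Fin (N + 1))} (hx : ‖x‖ = 1) :
    rhs ε q f φ x ≤ sigma k (1 : Matrix (Fin N) (Fin N) ℝ) / m * K *
      √(1 + ‖fderiv ℝ f x‖ ^ 2) ^ k := by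
  have h1 := h.exp_le hk hkn hx
  have hpos : 0 < sigma k (1 : Matrix (Fin N) (Fin N) ℝ) / m := (Real.exp_pos _).trans_le h1
  have h2 : (1 + ‖fderiv ℝ f x‖ ^ 2) ^ q ≤ √(1 + ‖fderiv ℝ f x‖ ^ 2) ^ k := by
    rw [Real.sqrt_eq_rpow, ← Real.rpow_natCast _ k, ← Real.rpow_mul (by positivity)]
    refine Real.rpow_le_rpow_of_exponent_le (by linarith [sq_nonneg ‖fderiv ℝ f x‖]) ?_
    linarith [h.hq]
  have h3 := h.rhs_le x hx
  have h4 : 0 ≤ φ x := h.hm.le.trans (h.le_rhs x hx)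
  calc rhs ε q f φ x ≤ sigma k (1 : Matrix (Fin N) (Fin N) ℝ) / m *
        √(1 + ‖fderiv ℝ f x‖ ^ 2) ^ k * K := by unfold rhs; gcongr
    _ = _ := by ring

theorem continuousAt_rhs {f φ : EuclideanSpace ℝ (Fin (N + 1)) → ℝ}
    (h : IsLogSolution k ε q m K f φ) {x : EuclideanSpace ℝ (Fin (N + 1))} (hx : x ≠ 0) :
    ContinuousAt (rhs ε q f φ) x := by
  have h1 := (h.contDiffAt x hx).continuousAt
  have h2 : ContinuousAt (fderiv ℝ f) x :=
    ((h.contDiffAt x hx).fderiv_right (m := 1) (by norm_num)).continuousAt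
  have h3 := (h.differentiableAt x hx).continuousAt
  refine ((Real.continuous_exp.continuousAt.comp (continuousAt_const.mul h1)).mul ?_).mul h3
  refine (continuousAt_const.add (h2.norm.pow 2)).rpow_const (Or.inl ?_)
  exact (by positivity : (1 : ℝ) + ‖fderiv ℝ f x‖ ^ 2 ≠ 0)

/-- The gradient factors coincide and the exponential is no larger at y, because f(y) ≤ f(x). Only
the Lipschitz bound for φ contributes, made relative to the right side through φ ≥ m. -/
theorem rhs_sub_le {f φ : EuclideanSpace ℝ (Fin (N + 1)) → ℝ}
    (h : IsLogSolution k ε q m K f φ) {κ : ℝ} (hκ : 0 ≤ κ) {x y : EuclideanSpace ℝ (Fin (N + 1))}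
    (hx : ‖x‖ = 1) (hy : ‖y‖ = 1) (hmax : IsDoubledMax f κ x y) (hc : 0 < ⟪x, y⟫)
    (hr : ‖x - y‖ ≤ 1 / 2) :
    rhs ε q f φ y - rhs ε q f φ x ≤
      K / m * (‖x - y‖ * (1 + 2 * ‖x - y‖)) * rhs ε q f φ y := by
  obtain ⟨hn1, hn2⟩ := norm_fderiv_of_isDoubledMax h.contDiffAt h.hom hκ hx hy hmax hc
  have hxy : f y ≤ f x := by
    have h1 := hmax x x (ne_zero_of_norm_eq_one hx) (ne_zero_of_norm_eq_one hx)
    rw [real_inner_self_eq_norm_sq, hx, inner_eq_of_norm_eq_one hx hy] at h1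
    norm_num at h1
    nlinarith [mul_nonneg hκ (sq_nonneg ‖x - y‖)]
  have hexp : Real.exp (ε * f y) ≤ Real.exp (ε * f x) := by
    gcongr
    exact h.hε
  have hφ := abs_sub_le_of_near h.hom_rhs h.differentiableAt h.fderiv_rhs_le h.K_pos.le hx hr
  have hφx := h.hm.trans_le (h.le_rhs x hx)
  have hφy := h.le_rhs y hy
  unfold rhs
  rw [hn1, hn2]
  set G := (1 + (κ * √(1 - ⟪x, y⟫ ^ 2)) ^ 2) ^ q
  have hGpos : 0 < G := Real.rpow_pos_of_pos (by positivity) _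
  set A := Real.exp (ε * f x)
  set B := Real.exp (ε * f y)
  have hB : 0 < B := Real.exp_pos _
  set r := ‖x - y‖
  have hr0 : 0 ≤ r := norm_nonneg _
  have hφ' : φ y - φ x ≤ K * r * (1 + 2 * r) := by
    rw [abs_sub_comm] at hφ; exact (le_abs_self _).trans hφ
  have hKm : K * r * (1 + 2 * r) ≤ K / m * (r * (1 + 2 * r)) * φ y := by
    have hK := h.K_pos
    have h1 : K / m * (r * (1 + 2 * r)) * m ≤ K / m * (r * (1 + 2 * r)) * φ y := by
      have := h.hm; gcongr
    have h2 : K / m * (r * (1 + 2 * r)) * m = K * r * (1 + 2 * r) := by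
      have := h.hm.ne'; field_simp
    linarith
  calc B * G * φ y - A * G * φ x ≤ B * G * φ y - B * G * φ x := by gcongr
    _ = B * G * (φ y - φ x) := by ring
    _ ≤ B * G * (K / m * (r * (1 + 2 * r)) * φ y) := by
      have := hφ'.trans hKm
      gcongr
    _ = _ := by ring

/-- The gradient bound for `k ≥ 2` at a point of maximal gradient. -/
theorem le_of_two_le {f φ : EuclideanSpace ℝ (Fin (N + 2)) → ℝ} {l : ℕ} (hl : l + 2 ≤ N + 1)
    (h : IsLogSolution (l + 2) ε q m K f φ) {L : ℝ} (hL : 1 ≤ L)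
    (hG : ∀ x, ‖x‖ = 1 → ‖fderiv ℝ f x‖ ≤ L)
    {z : EuclideanSpace ℝ (Fin (N + 2))} (hz : ‖z‖ = 1) (hzL : ‖fderiv ℝ f z‖ = L) :
    L ≤ 2 * (K / m) * (sigma (l + 2) (1 : Matrix (Fin (N + 1)) (Fin (N + 1)) ℝ) / m * K) *
      (1 + 2 * (2 * (K / m))) ^ l := by
  obtain ⟨κ, x, y, ex, ey, x₀, e₀, ⟨hκ, hx, hy, hmax, hc, hr, hfr, hrl, hql, hxl, hyl, hel⟩,
    hx₀, he₀, hxe₀, hDn, -, hrow⟩ := exists_frame_sequence_with_limit h.contDiffAt h.hom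
      (by linarith) hG hz hzL
  have hx₀0 := ne_zero_of_norm_eq_one hx₀
  have hKm : 0 < K / m := div_pos h.K_pos h.hm
  set W₀ := logHess f x₀ e₀ with hW₀
  have hW₀h : W₀.IsHermitian := logHess_isHermitian (h.contDiffAt x₀ hx₀0) e₀
  have heq₀ := h.equation x₀ hx₀ e₀ he₀ hxe₀
  set Q := rhs ε q f φ x₀ with hQ
  have hQpos : 0 < Q := h.rhs_pos hx₀
  have hWl : Tendsto (fun j => logHess f (x j) (ex j)) atTop (𝓝 W₀) :=
    tendsto_logHess h.contDiffAt hx₀0 hxl hel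
  have hyQ : Tendsto (fun j => rhs ε q f φ (y j)) atTop (𝓝 Q) :=
    (h.continuousAt_rhs hx₀0).tendsto.comp hyl
  set τ : ℕ → ℝ := fun j => κ j * ‖x j - y j‖ ^ 2 with hτ
  have hτ0 : ∀ j, 0 < τ j := fun j => mul_pos (hκ j) (pow_pos (hr j) 2)
  have hτl : Tendsto τ atTop (𝓝 0) := by
    have := hql.mul hrl
    rw [mul_zero] at this
    refine this.congr fun j => ?_
    rw [hτ]; ring
  obtain ⟨D, hD⟩ : ∃ D, HasDerivAt (fun t : ℝ => sigmaCoeff (l + 2) (W₀ + t • tailProj N)) D 0 := by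
    let w₀ : Fin (N + 1) → Fin (N + 1) → ℝ := W₀
    let p₀ : Fin (N + 1) → Fin (N + 1) → ℝ := tailProj N
    have h1 : DifferentiableAt ℝ (fun t : ℝ => w₀ + t • p₀) 0 := by fun_prop
    have h2 := (((contDiff_sigmaCoeff (n := N + 1) (l + 2)).differentiable
      one_ne_zero).differentiableAt (x := w₀ + (0 : ℝ) • p₀)).comp (0 : ℝ) h1
    exact ⟨_, h2.hasDerivAt⟩
  have hslope := tendsto_slope_sigmaCoeff (l + 2) hWl hτl
    (Eventually.of_forall fun j => (hτ0 j).ne') hD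
  have hstep : ∀ᶠ j in atTop, (κ j * ‖x j - y j‖) * ((τ j)⁻¹ *
      (sigmaCoeff (l + 2) (logHess f (x j) (ex j) + τ j • tailProj N) -
        sigmaCoeff (l + 2) (logHess f (x j) (ex j)))) ≤
      K / m * (1 + 2 * ‖x j - y j‖) * rhs ε q f φ (y j) := by
    filter_upwards [hrl.eventually (ge_mem_nhds (show (0 : ℝ) < 1 / 2 by norm_num))] with j hj
    have hWx := logHess_isHermitian (h.contDiffAt _ (ne_zero_of_norm_eq_one (hx j))) (ex j)
    have hGx := h.admissible (x j) (hx j) (ex j) (hfr j).orthonormal_left (hfr j).inner_left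
    have hP : (τ j • tailProj N).PosSemidef := tailProj_posSemidef.smul (hτ0 j).le
    -- Two moves inside Γ_k: from W(x) to W(x) + τP, then across the nonnegative gap to W(y).
    have hA := hGx.add_posSemidef hl hWx hP
    have hAh := hWx.add hP.isHermitian
    have hB := hA.1.add_posSemidef hl hAh
      (posSemidef_of_isDoubledMax h.contDiffAt (hκ j).le (hx j) (hy j) (hmax j) (hc j) (hfr j))
    have hB2 := hB.2 (l + 2) (by omega) le_rfl
    rw [add_sub_cancel, h.equation (y j) (hy j) (ey j) (hfr j).orthonormal_right
      (hfr j).inner_right] at hB2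
    have hC := h.rhs_sub_le (hκ j).le (hx j) (hy j) (hmax j) (hc j) hj
    rw [← h.equation (x j) (hx j) (ex j) (hfr j).orthonormal_left (hfr j).inner_left] at hC
    rw [← sigma_eq_sigmaCoeff hl hAh, ← sigma_eq_sigmaCoeff hl hWx]
    have hr' := hr j
    have hκ' := hκ j
    have h5 : sigma (l + 2) (logHess f (x j) (ex j) + τ j • tailProj N) -
        sigma (l + 2) (logHess f (x j) (ex j)) ≤
        K / m * (‖x j - y j‖ * (1 + 2 * ‖x j - y j‖)) * rhs ε q f φ (y j) := by linarith
    have h6 : (κ j * ‖x j - y j‖) * (τ j)⁻¹ = ‖x j - y j‖⁻¹ := by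
      rw [hτ]; field_simp
    rw [← mul_assoc, h6]
    calc _ ≤ ‖x j - y j‖⁻¹ * (K / m * (‖x j - y j‖ * (1 + 2 * ‖x j - y j‖)) * rhs ε q f φ (y j)) := by
          gcongr
      _ = _ := by field_simp
  -- The prefactor κ|x-y| tends to L and the difference quotients in the direction P tend to D.
  have hLD : L * D ≤ K / m * Q := by
    have h1 := hql.mul hslope
    have h2 := ((((hrl.const_mul 2).const_add 1).const_mul (K / m)).mul hyQ)
    have h3 := le_of_tendsto_of_tendsto h1 h2 hstep
    simpa using h3
  set R := √(1 + L ^ 2) with hR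
  have hR2 : R ^ 2 = 1 + L ^ 2 := Real.sq_sqrt (by positivity)
  have hR1 : 1 ≤ R := (sq_le_sq₀ zero_le_one (Real.sqrt_nonneg _)).1 (by
    rw [hR2, one_pow]; linarith [sq_nonneg L])
  have hRL : R ≤ 2 * L := (sq_le_sq₀ (Real.sqrt_nonneg _) (by linarith)).1 (by
    rw [hR2]; nlinarith)
  have hLR : L ≤ R := (sq_le_sq₀ (by linarith) (Real.sqrt_nonneg _)).1 (by rw [hR2]; linarith)
  -- The factor 2 is the price of R ≤ 2L, which uses L ≥ 1.
  have hRD : R * D ≤ 2 * (K / m) * sigma (l + 2) W₀ := by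
    rw [heq₀]
    rcases le_or_gt D 0 with h0 | h0
    · exact (mul_nonpos_of_nonneg_of_nonpos (by linarith) h0).trans (by positivity)
    · nlinarith
  refine hLR.trans (bound_of_derivative_bound hl hW₀h (h.admissible x₀ hx₀ e₀ he₀ hxe₀) hR1
    (by positivity) (fun j => ?_) ?_ hD hRD)
  · rw [hrow, hR2]
  · rw [heq₀, hR, ← hDn]
    exact h.rhs_le_pow (by omega) hl hx₀

/-- The gradient bound for `k = 1` at a point of maximal gradient. -/
theorem le_of_eq_one {f φ : EuclideanSpace ℝ (Fin (N + 2)) → ℝ}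
    (h : IsLogSolution 1 ε q m K f φ) {L : ℝ} (hL : 0 < L)
    (hG : ∀ x, ‖x‖ = 1 → ‖fderiv ℝ f x‖ ≤ L)
    {z : EuclideanSpace ℝ (Fin (N + 2))} (hz : ‖z‖ = 1) (hzL : ‖fderiv ℝ f z‖ = L) :
    L ≤ (4 + K / m) * (sigma 1 (1 : Matrix (Fin (N + 1)) (Fin (N + 1)) ℝ) / m * K) + 3 * N := by
  obtain ⟨κ, x, y, ex, ey, x₀, e₀, ⟨hκ, hx, hy, hmax, hc, hr, hfr, hrl, hql, hxl, hyl, hel⟩,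
    hx₀, he₀, hxe₀, hDn, hD00, hrow⟩ := exists_frame_sequence_with_limit h.contDiffAt h.hom
      hL hG hz hzL
  have hx₀0 := ne_zero_of_norm_eq_one hx₀
  have hKm : 0 < K / m := div_pos h.K_pos h.hm
  have hyQ : Tendsto (fun j => rhs ε q f φ (y j)) atTop (𝓝 (rhs ε q f φ x₀)) :=
    (h.continuousAt_rhs hx₀0).tendsto.comp hyl
  have hQ := h.rhs_le_pow le_rfl (by omega) hx₀
  set Q := rhs ε q f φ x₀
  have htail : ∀ (p : EuclideanSpace ℝ (Fin (N + 2)))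
      (e : Fin (N + 1) → EuclideanSpace ℝ (Fin (N + 2))), ‖p‖ = 1 → Orthonormal ℝ e →
      (∀ i, ⟪p, e i⟫ = 0) → logHess f p e 0 0 +
        ∑ i : Fin N, logHess f p e i.succ i.succ = rhs ε q f φ p := by
    intro p e hp he hpe
    rw [← h.equation p hp e he hpe, sigma_one_eq_trace _
      (logHess_isHermitian (h.contDiffAt p (ne_zero_of_norm_eq_one hp)) e), trace,
      Fin.sum_univ_succ]
    rfl
  have hlx : Tendsto (fun j => ∑ i : Fin N, logHess f (x j) (ex j) i.succ i.succ) atTop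
      (𝓝 (∑ i : Fin N, logHess f x₀ e₀ i.succ i.succ)) := by
    refine tendsto_finsetSum _ fun i _ => ?_
    exact tendsto_pi_nhds.1 (tendsto_pi_nhds.1
      (tendsto_logHess h.contDiffAt hx₀0 hxl hel) i.succ) i.succ
  have hly : Tendsto (fun j => ∑ i : Fin N, logHess f (y j) (ey j) i.succ i.succ) atTop
      (𝓝 (∑ i : Fin N, logHess f x₀ e₀ i.succ i.succ)) := by
    refine tendsto_finsetSum _ fun i _ => ?_
    have := tendsto_pi_nhds.1 (tendsto_pi_nhds.1
      (tendsto_logHess h.contDiffAt hx₀0 hyl hel) i.succ) i.succ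
    refine this.congr fun j => ?_
    simp only [logHess, of_apply, (hfr j).eq_of_ne i.succ (Fin.succ_ne_zero i)]
  have h0 := htail x₀ e₀ hx₀ he₀ hxe₀
  rw [hrow, if_pos rfl] at h0
  set T := ∑ i : Fin N, logHess f x₀ e₀ i.succ i.succ
  -- With r = |x-y| and TA, TB the tail traces at x and y less N, the scaled variation gives
  -- (1+r²)(TA - TB) - 2r(TA + TB) ≤ 3Nκr². The equation gives TA - TB ≥ -O(r), so one factor r can
  -- be cancelled.
  have hstep : ∀ᶠ j in atTop,
      -((1 + ‖x j - y j‖ ^ 2) * (K / m * (1 + 2 * ‖x j - y j‖)) * rhs ε q f φ (y j)) -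
        2 * ((∑ i : Fin N, logHess f (x j) (ex j) i.succ i.succ - N) +
          (∑ i : Fin N, logHess f (y j) (ey j) i.succ i.succ - N)) ≤
      3 * N * (κ j * ‖x j - y j‖) := by
    filter_upwards [hrl.eventually (ge_mem_nhds (show (0 : ℝ) < 1 / 2 by norm_num))] with j hj
    have hC := h.rhs_sub_le (hκ j).le (hx j) (hy j) (hmax j) (hc j) hj
    have hx1 := htail (x j) (ex j) (hx j) (hfr j).orthonormal_left (hfr j).inner_left
    have hy1 := htail (y j) (ey j) (hy j) (hfr j).orthonormal_right (hfr j).inner_right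
    have h00 : logHess f (x j) (ex j) 0 0 ≤ logHess f (y j) (ey j) 0 0 := by
      have := (posSemidef_of_isDoubledMax h.contDiffAt (hκ j).le (hx j) (hy j) (hmax j) (hc j)
        (hfr j)).diag_nonneg (i := 0)
      rw [Matrix.sub_apply, Matrix.add_apply, Matrix.smul_apply, tailProj, diagonal_apply_eq,
        if_pos rfl, smul_zero, add_zero] at this
      linarith
    have hsum : (1 + -‖x j - y j‖) ^ 2 * (∑ i : Fin N, logHess f (x j) (ex j) i.succ i.succ - N) -
        (1 - -‖x j - y j‖) ^ 2 * (∑ i : Fin N, logHess f (y j) (ey j) i.succ i.succ - N) ≤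
        N * (κ j * (3 * ‖x j - y j‖ ^ 2)) := by
      have hi : ∀ i : Fin N, (1 + -‖x j - y j‖) ^ 2 * (logHess f (x j) (ex j) i.succ i.succ - 1) -
          (1 - -‖x j - y j‖) ^ 2 * (logHess f (y j) (ey j) i.succ i.succ - 1) ≤
          κ j * (3 * ‖x j - y j‖ ^ 2) := by
        intro i
        -- The choice σ = -|x-y| makes the cost κ(4σ² - |x-y|²) equal to 3κ|x-y|², while the speeds
        -- still differ to first order.
        have h1 := snd_variation_scaled h.contDiffAt (hκ j).le (hx j) (hy j) (hmax j) (hc j)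
          (hfr j) (-‖x j - y j‖) (Fin.succ_ne_zero i)
        have h2 := fderiv_frame_of_isDoubledMax h.contDiffAt (hκ j).le (hx j) (hy j) (hmax j)
          (hc j) (hfr j) i.succ
        simp only [Fin.succ_ne_zero, if_false] at h2
        simp only [logHess, of_apply, h2, if_true, mul_zero, add_zero, add_sub_cancel_right]
        linarith
      have := Finset.sum_le_sum fun i (_ : i ∈ Finset.univ) => hi i
      rw [Finset.sum_sub_distrib, ← Finset.mul_sum, ← Finset.mul_sum, Finset.sum_sub_distrib,
        Finset.sum_sub_distrib] at this
      simpa using this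
    set TA := ∑ i : Fin N, logHess f (x j) (ex j) i.succ i.succ - N
    set TB := ∑ i : Fin N, logHess f (y j) (ey j) i.succ i.succ - N
    set r := ‖x j - y j‖
    have hr' : 0 < r := hr j
    have hdiff : -(K / m * (r * (1 + 2 * r)) * rhs ε q f φ (y j)) ≤ TA - TB := by linarith
    have hdiff2 := mul_le_mul_of_nonneg_left hdiff (by positivity : 0 ≤ 1 + r ^ 2)
    refine le_of_mul_le_mul_left ?_ hr'
    nlinarith
  -- Since T = Q - (1 + L²), the left side contains 4R², against Q ≤ C₀R and a right side linear in
  -- L.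
  have hlim : -((1 + (0 : ℝ) ^ 2) * (K / m * (1 + 2 * 0)) * Q) - 2 * ((T - N) + (T - N)) ≤
      3 * N * L := by
    refine le_of_tendsto_of_tendsto ?_ (hql.const_mul _) hstep
    refine Tendsto.sub (Tendsto.neg ?_) ?_
    · exact (((hrl.pow 2).const_add 1).mul (((hrl.const_mul 2).const_add 1).const_mul _)).mul hyQ
    · exact ((hlx.sub_const _).add (hly.sub_const _)).const_mul 2
  have hQ' : Q ≤ sigma 1 (1 : Matrix (Fin (N + 1)) (Fin (N + 1)) ℝ) / m * K * √(1 + L ^ 2) := by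
    rw [hDn, pow_one] at hQ; exact hQ
  set C₀ := sigma 1 (1 : Matrix (Fin (N + 1)) (Fin (N + 1)) ℝ) / m * K
  set R := √(1 + L ^ 2) with hR
  have hR2 : R ^ 2 = 1 + L ^ 2 := Real.sq_sqrt (by positivity)
  have hR0 : 0 < R := Real.sqrt_pos.2 (by positivity)
  have hLR : L ≤ R := (sq_le_sq₀ (by linarith) (Real.sqrt_nonneg _)).1 (by rw [hR2]; linarith)
  have hN : (0 : ℝ) ≤ N := Nat.cast_nonneg N
  refine hLR.trans (le_of_mul_le_mul_right ?_ hR0)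
  have h7 : (4 + K / m) * Q ≤ (4 + K / m) * (C₀ * R) := by gcongr
  have h8 : 3 * N * L ≤ 3 * N * R := by gcongr
  nlinarith

/-- The gradient bound. -/
theorem norm_fderiv_le {f φ : EuclideanSpace ℝ (Fin (N + 2)) → ℝ} (hk : 1 ≤ k) (hkn : k ≤ N + 1)
    (h : IsLogSolution k ε q m K f φ) {x : EuclideanSpace ℝ (Fin (N + 2))} (hx : ‖x‖ = 1) :
    ‖fderiv ℝ f x‖ ≤ max 1 (max
      (2 * (K / m) * (sigma k (1 : Matrix (Fin (N + 1)) (Fin (N + 1)) ℝ) / m * K) *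
        (1 + 2 * (2 * (K / m))) ^ (k - 2))
      ((4 + K / m) * (sigma k (1 : Matrix (Fin (N + 1)) (Fin (N + 1)) ℝ) / m * K) + 3 * N)) := by
  obtain ⟨z, hz, hzmax⟩ := (isCompact_sphere (0 : EuclideanSpace ℝ (Fin (N + 2))) 1).exists_isMaxOn
    (NormedSpace.sphere_nonempty.2 zero_le_one) (f := fun y => ‖fderiv ℝ f y‖) fun y hy =>
      (((h.contDiffAt y (ne_zero_of_norm_eq_one (mem_sphere_zero_iff_norm.1 hy))).fderiv_right
        (m := 1) (by norm_num)).continuousAt.norm).continuousWithinAt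
  have hz1 := mem_sphere_zero_iff_norm.1 hz
  have hG : ∀ y, ‖y‖ = 1 → ‖fderiv ℝ f y‖ ≤ ‖fderiv ℝ f z‖ := fun y hy =>
    hzmax (mem_sphere_zero_iff_norm.2 hy)
  refine (hG x hx).trans ?_
  rcases le_or_gt ‖fderiv ℝ f z‖ 1 with h1 | h1
  · exact h1.trans (le_max_left _ _)
  · refine le_trans ?_ (le_max_right _ _)
    rcases hk.eq_or_lt with rfl | hk2
    · exact (h.le_of_eq_one (by linarith) hG hz1 rfl).trans (le_max_right _ _)
    · obtain ⟨l, rfl⟩ : ∃ l, k = l + 2 := ⟨k - 2, by omega⟩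
      exact (h.le_of_two_le hkn h1.le hG hz1 rfl).trans (le_max_left _ _)

end IsLogSolution

end Sph

/-! ### Translation between u and log u, and the oscillation bound. -/

namespace Sph

open Filter Topology Metric RealInnerProductSpace Matrix

variable {n : ℕ}

theorem snd_fderiv_of_log {E : Type*} [NormedAddCommGroup E] [InnerProductSpace ℝ E]
    {F : E → ℝ} (hF : ∀ y, y ≠ 0 → ContDiffAt ℝ 2 F y) (hpos : ∀ y, y ≠ 0 → 0 < F y) {x : E}
    (hx : x ≠ 0) :
    fderiv ℝ F x = F x • fderiv ℝ (fun y => Real.log (F y)) x ∧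
    ∀ ξ η : E, fderiv ℝ (fderiv ℝ F) x ξ η =
      F x * (fderiv ℝ (fderiv ℝ fun y => Real.log (F y)) x ξ η +
        fderiv ℝ (fun y => Real.log (F y)) x ξ * fderiv ℝ (fun y => Real.log (F y)) x η) := by
  have h1 : ∀ y, y ≠ 0 → fderiv ℝ F y = F y • fderiv ℝ (fun y => Real.log (F y)) y := by
    intro y hy
    rw [fderiv.log ((hF y hy).differentiableAt two_ne_zero) (hpos y hy).ne', smul_smul,
      mul_inv_cancel₀ (hpos y hy).ne', one_smul]
  refine ⟨h1 x hx, fun ξ η => ?_⟩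
  have h2 : fderiv ℝ F =ᶠ[𝓝 x] fun y => F y • fderiv ℝ (fun y => Real.log (F y)) y := by
    filter_upwards [isOpen_ne.mem_nhds hx] with y hy using h1 y hy
  have hlog : ContDiffAt ℝ 2 (fun y => Real.log (F y)) x := (hF x hx).log (hpos x hx).ne'
  have h3 := (((hF x hx).differentiableAt two_ne_zero).hasFDerivAt).smul
    ((hlog.fderiv_right (m := 1) (by norm_num)).differentiableAt one_ne_zero).hasFDerivAt
  have h4 : fderiv ℝ (fderiv ℝ F) x = _ := h2.fderiv_eq.trans h3.fderiv
  rw [h4, h1 x hx]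
  simp
  ring

theorem bMatrix_eq_smul_logHess {u : Sph n → ℝ} (hu : ContMDiff (𝓡 n) 𝓘(ℝ, ℝ) 2 u)
    (hpos : ∀ x, 0 < u x) (x : Sph n) (e : OrthonormalBasis (Fin n) ℝ (tangent x)) :
    bMatrix u x e = u x • logHess (fun y => Real.log (ext u y))
      (x : EuclideanSpace ℝ (Fin (n + 1))) fun i => (e i : EuclideanSpace ℝ (Fin (n + 1))) := by
  have hx := ne_zero_of_norm_eq_one (mem_sphere_zero_iff_norm.1 x.2)
  have h := (snd_fderiv_of_log (fun y hy => contDiffAt_ext hu hy) (fun y hy => ext_pos hpos hy) hx).2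
  ext i j
  rw [bMatrix, of_apply, hess, h, ext_coe, Matrix.smul_apply, logHess, of_apply, smul_eq_mul,
    ← mul_add]

theorem exists_orthonormalBasis_tangent (x : Sph n) {e : Fin n → EuclideanSpace ℝ (Fin (n + 1))}
    (he : Orthonormal ℝ e) (hx : ∀ i, ⟪(x : EuclideanSpace ℝ (Fin (n + 1))), e i⟫ = 0) :
    ∃ b : OrthonormalBasis (Fin n) ℝ (tangent x),
      (fun i => (b i : EuclideanSpace ℝ (Fin (n + 1)))) = e := by
  have hx0 := ne_zero_of_norm_eq_one (mem_sphere_zero_iff_norm.1 x.2)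
  have : Fact (Module.finrank ℝ (EuclideanSpace ℝ (Fin (n + 1))) = n + 1) :=
    ⟨finrank_euclideanSpace_fin⟩
  have hmem : ∀ i, e i ∈ tangent x := fun i => by
    rw [tangent, Submodule.mem_orthogonal_singleton_iff_inner_right]; exact hx i
  set v : Fin n → tangent x := fun i => ⟨e i, hmem i⟩ with hv
  have hon : Orthonormal ℝ v := by
    rw [orthonormal_iff_ite] at he ⊢
    exact he
  have hfr : Fintype.card (Fin n) = Module.finrank ℝ (tangent x) := by
    rw [Fintype.card_fin, tangent, Submodule.finrank_orthogonal_span_singleton (n := n) hx0]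
  refine ⟨OrthonormalBasis.mk hon
    (hon.linearIndependent.span_eq_top_of_card_eq_finrank' hfr).ge, ?_⟩
  ext1 i
  rw [OrthonormalBasis.coe_mk]

theorem norm_grad_eq {u : Sph n → ℝ} (hu : ContMDiff (𝓡 n) 𝓘(ℝ, ℝ) 2 u)
    (hpos : ∀ x, 0 < u x) (x : Sph n) :
    ‖grad u x‖ = u x * ‖fderiv ℝ (fun y => Real.log (ext u y))
      (x : EuclideanSpace ℝ (Fin (n + 1)))‖ := by
  have hx := ne_zero_of_norm_eq_one (mem_sphere_zero_iff_norm.1 x.2)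
  rw [norm_grad, (snd_fderiv_of_log (fun y hy => contDiffAt_ext hu hy)
    (fun y hy => ext_pos hpos hy) hx).1, norm_smul, ext_coe, Real.norm_of_nonneg (hpos x).le]

theorem bddAbove_norm_grad {φ : Sph n → ℝ} (hφ : ContMDiff (𝓡 n) 𝓘(ℝ, ℝ) ∞ φ) :
    BddAbove (Set.range fun x => ‖grad φ x‖) := by
  have hc : Continuous fun x : Sph n => ‖grad φ x‖ := by
    simp only [norm_grad]
    refine continuous_iff_continuousAt.2 fun x => ?_
    have hx := ne_zero_of_norm_eq_one (mem_sphere_zero_iff_norm.1 x.2)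
    have h1 : ContDiffAt ℝ 1 (ext φ) (x : EuclideanSpace ℝ (Fin (n + 1))) :=
      (contDiffAt_ext hφ hx).of_le (by simp)
    have h2 : ContinuousAt (fderiv ℝ (ext φ)) (x : EuclideanSpace ℝ (Fin (n + 1))) :=
      (h1.fderiv_right (m := 0) (by norm_num)).continuousAt
    exact (h2.comp continuous_subtype_val.continuousAt).norm
  exact (isCompact_range hc).bddAbove

theorem le_of_normC1_le {φ : Sph n → ℝ} (hφ : ContMDiff (𝓡 n) 𝓘(ℝ, ℝ) ∞ φ) {K : ℝ}
    (hK : normC1 φ ≤ K) (x : Sph n) : φ x ≤ K ∧ ‖grad φ x‖ ≤ K := by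
  have h1 : BddAbove (Set.range fun x => |φ x|) :=
    (isCompact_range hφ.continuous.abs).bddAbove
  have h2 := le_ciSup h1 x
  have h3 := le_ciSup (bddAbove_norm_grad hφ) x
  have h4 := abs_nonneg (φ x)
  have h5 := norm_nonneg (grad φ x)
  have h6 := le_abs_self (φ x)
  unfold normC1 at hK
  constructor <;> linarith

/-- The powers of u balance: u^{p-1+ε} u^{k+1-p} = u^k u^ε, and u^k cancels against σ_k(uW) = u^k
σ_k(W), leaving u^ε = e^{εf}. -/
theorem isLogSolution_log_ext {k : ℕ} {m K p ε : ℝ} (hm : 0 < m) (hp : 1 < p)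
    (hε : 0 < ε) {φ u : Sph n → ℝ} (hφ : ContMDiff (𝓡 n) 𝓘(ℝ, ℝ) ∞ φ) (hφpos : ∀ x, 0 < φ x)
    (hφm : m ≤ ⨅ x, φ x) (hφK : normC1 φ ≤ K) (hu : ContMDiff (𝓡 n) 𝓘(ℝ, ℝ) 2 u)
    (hupos : ∀ x, 0 < u x) (hadm : IsAdmissible k u) (hsol : IsSolution k p ε φ u) :
    IsLogSolution k ε (((k : ℝ) + 1 - p) / 2) m K (fun y => Real.log (ext u y)) (ext φ) := by
  have hdiff : ∀ y, y ≠ 0 → ContDiffAt ℝ 2 (fun y => Real.log (ext u y)) y := fun y hy =>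
    (contDiffAt_ext hu hy).log (ext_pos hupos hy).ne'
  have hφx : ∀ x : EuclideanSpace ℝ (Fin (n + 1)), ∀ hx : ‖x‖ = 1,
      ext φ x = φ ⟨x, mem_sphere_zero_iff_norm.2 hx⟩ := fun x hx =>
    ext_coe φ ⟨x, mem_sphere_zero_iff_norm.2 hx⟩
  have hframe : ∀ x : EuclideanSpace ℝ (Fin (n + 1)), ‖x‖ = 1 →
      ∀ e : Fin n → EuclideanSpace ℝ (Fin (n + 1)), Orthonormal ℝ e → (∀ i, ⟪x, e i⟫ = 0) →
      InGamma k (logHess (fun y => Real.log (ext u y)) x e) ∧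
      sigma k (logHess (fun y => Real.log (ext u y)) x e) =
        rhs ε (((k : ℝ) + 1 - p) / 2) (fun y => Real.log (ext u y)) (ext φ) x := by
    intro x hx e he hxe
    set xs : Sph n := ⟨x, mem_sphere_zero_iff_norm.2 hx⟩
    obtain ⟨b, rfl⟩ := exists_orthonormalBasis_tangent xs he hxe
    have hW := logHess_isHermitian (hdiff x (ne_zero_of_norm_eq_one hx))
      fun i => (b i : EuclideanSpace ℝ (Fin (n + 1)))
    have hb := bMatrix_eq_smul_logHess hu hupos xs b
    have hux := hupos xs
    constructor
    · intro i hi hik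
      have h1 := hadm xs b i hi hik
      rw [hb, sigma_smul i hW] at h1
      exact pos_of_mul_pos_right h1 (pow_pos hux i).le
    · have h1 := hsol xs b
      rw [hb, sigma_smul k hW, norm_grad_eq hu hupos] at h1
      change u xs ^ k * sigma k (logHess (fun y => Real.log (ext u y)) x _) = _ at h1
      refine mul_left_cancel₀ (pow_pos hux k).ne' (h1.trans ?_)
      have hext : ext u x = u xs := ext_coe u xs
      rw [rhs, hext, show ext φ x = φ xs from ext_coe φ xs]
      change _ * (u xs ^ 2 + (u xs * ‖fderiv ℝ (fun y => Real.log (ext u y)) x‖) ^ 2) ^ _ * _ = _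
      set G := ‖fderiv ℝ (fun y => Real.log (ext u y)) x‖
      set q := ((k : ℝ) + 1 - p) / 2 with hq
      have h2 : u xs ^ 2 + (u xs * G) ^ 2 = u xs ^ 2 * (1 + G ^ 2) := by ring
      have h3 : (u xs ^ 2) ^ q = u xs ^ ((k : ℝ) + 1 - p) := by
        rw [← Real.rpow_natCast _ 2, ← Real.rpow_mul hux.le, hq]
        congr 1
        push_cast; ring
      have h4 : Real.exp (ε * Real.log (u xs)) = u xs ^ ε := by
        rw [Real.rpow_def_of_pos hux, mul_comm]
      have h5 : u xs ^ (p - 1 + ε) * u xs ^ ((k : ℝ) + 1 - p) = u xs ^ k * u xs ^ ε := by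
        rw [← Real.rpow_add hux, ← Real.rpow_natCast, ← Real.rpow_add hux]
        congr 1
        ring
      rw [h2, Real.mul_rpow (by positivity) (by positivity), h3, h4, ← mul_assoc, h5]
      ring
  exact
    { hε := hε.le
      hq := by linarith
      hm := hm
      contDiffAt := hdiff
      hom := fun t ht y => by simp only [ext_smul u ht]
      differentiableAt := fun y hy => (contDiffAt_ext hφ hy).differentiableAt (by simp)
      hom_rhs := fun t ht y => ext_smul φ ht y
      le_rhs := fun x hx => by
        rw [hφx x hx]
        exact hφm.trans (ciInf_le ⟨0, by rintro _ ⟨y, rfl⟩; exact (hφpos y).le⟩ _)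
      rhs_le := fun x hx => by
        rw [hφx x hx]; exact (le_of_normC1_le hφ hφK _).1
      fderiv_rhs_le := fun x hx => by
        have := (le_of_normC1_le hφ hφK ⟨x, mem_sphere_zero_iff_norm.2 hx⟩).2
        rwa [norm_grad] at this
      admissible := fun x hx e he hxe => (hframe x hx e he hxe).1
      equation := fun x hx e he hxe => (hframe x hx e he hxe).2 }

/-- A gradient bound on the unit sphere bounds the oscillation. -/
theorem abs_sub_le_on_sphere {N : ℕ} {f : EuclideanSpace ℝ (Fin (N + 2)) → ℝ}
    (hom : ∀ t : ℝ, 0 < t → ∀ y, f (t • y) = f y) (hf : ∀ y, y ≠ 0 → DifferentiableAt ℝ f y)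
    {G : ℝ} (hG : ∀ x, ‖x‖ = 1 → ‖fderiv ℝ f x‖ ≤ G) (hG0 : 0 ≤ G)
    {x y : EuclideanSpace ℝ (Fin (N + 2))} (hx : ‖x‖ = 1) (hy : ‖y‖ = 1) :
    |f x - f y| ≤ 8 * G := by
  -- A midpoint splits the path into two angles of at most π/2: the normalized sum, or any unit
  -- tangent vector when the points are antipodal.
  have hmid : ∃ z : EuclideanSpace ℝ (Fin (N + 2)), ‖z‖ = 1 ∧ 0 ≤ ⟪x, z⟫ ∧ 0 ≤ ⟪z, y⟫ := by
    rcases eq_or_ne (x + y) 0 with h | h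
    · obtain ⟨e, he, hxe⟩ := exists_orthonormal_frame hx
      refine ⟨e 0, he.1 0, (hxe 0).ge, ?_⟩
      rw [eq_neg_of_add_eq_zero_right h, inner_neg_right, real_inner_comm, hxe, neg_zero]
    · have hp := norm_pos_iff.2 h
      have h1 : -1 ≤ ⟪x, y⟫ := by
        have := abs_le.1 (abs_real_inner_le_norm x y)
        rw [hx, hy] at this
        linarith [this.1]
      refine ⟨‖x + y‖⁻¹ • (x + y), ?_, ?_, ?_⟩
      · rw [norm_smul, norm_inv, norm_norm, inv_mul_cancel₀ hp.ne']
      · rw [real_inner_smul_right, inner_add_right, real_inner_self_eq_norm_sq, hx]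
        exact mul_nonneg (inv_nonneg.2 hp.le) (by linarith)
      · rw [real_inner_smul_left, inner_add_left, real_inner_self_eq_norm_sq, hy]
        exact mul_nonneg (inv_nonneg.2 hp.le) (by linarith)
  obtain ⟨z, hz, h1, h2⟩ := hmid
  have h3 := abs_sub_le_of_inner_nonneg hom hf hG hG0 hx hz h1
  have h4 := abs_sub_le_of_inner_nonneg hom hf hG hG0 hz hy h2
  linarith [abs_sub_le (f x) (f z) (f y)]

theorem iSup_div_iInf_le {ι : Type*} [Nonempty ι] {u : ι → ℝ} (hu : ∀ x, 0 < u x) {B : ℝ}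
    (hB : 0 < B) (h : ∀ x y, u x ≤ B * u y) : (⨆ x, u x) / (⨅ x, u x) ≤ B := by
  obtain ⟨x₀⟩ := ‹Nonempty ι›
  have : Nonempty ι := ⟨x₀⟩
  have hbdd : BddAbove (Set.range u) := ⟨B * u x₀, by rintro _ ⟨x, rfl⟩; exact h x x₀⟩
  have h1 : (⨆ x, u x) / B ≤ ⨅ x, u x := le_ciInf fun y => by
    rw [div_le_iff₀' hB]; exact ciSup_le fun x => h x y
  have h2 : 0 < ⨆ x, u x := (hu x₀).trans_le (le_ciSup hbdd x₀)
  have h3 : 0 < ⨅ x, u x := (div_pos h2 hB).trans_le h1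
  rw [div_le_iff₀ h3]
  rwa [div_le_iff₀' hB] at h1

end Sph

end

theorem theoremc1 (n k : ℕ) (hk : 1 ≤ k) (hkn : k ≤ n) (m K : ℝ) (hm : 0 < m) :
    ∃ C : ℝ, 0 < C ∧
      ∀ (p ε : ℝ), 1 < p → 0 < ε →
      ∀ φ : Sph n → ℝ, ContMDiff (𝓡 n) 𝓘(ℝ, ℝ) ∞ φ → (∀ x, 0 < φ x) →
        m ≤ ⨅ x, φ x → Sph.normC1 φ ≤ K →
      ∀ u : Sph n → ℝ, ContMDiff (𝓡 n) 𝓘(ℝ, ℝ) 2 u → (∀ x, 0 < u x) →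
        Sph.IsAdmissible k u → Sph.IsSolution k p ε φ u →
        (∀ x, ‖Sph.grad u x‖ / u x ≤ C) ∧ (⨆ x, u x) / (⨅ x, u x) ≤ C := by
  obtain ⟨N, rfl⟩ : ∃ N, n = N + 1 := ⟨n - 1, by omega⟩
  -- The entry 1 covers L ≤ 1, the second the case k ≥ 2, the third k = 1; no entry involves p, ε, φ
  -- or u.
  set G : ℝ := max 1 (max
      (2 * (K / m) * (Sph.sigma k (1 : Matrix (Fin (N + 1)) (Fin (N + 1)) ℝ) / m * K) *
        (1 + 2 * (2 * (K / m))) ^ (k - 2))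
      ((4 + K / m) * (Sph.sigma k (1 : Matrix (Fin (N + 1)) (Fin (N + 1)) ℝ) / m * K) + 3 * N))
    with hGdef
  have hG1 : 1 ≤ G := le_max_left _ _
  refine ⟨max G (Real.exp (8 * G)), by positivity, ?_⟩
  intro p ε hp hε φ hφ hφpos hφm hφK u hu hupos hadm hsol
  have hlog := Sph.isLogSolution_log_ext hm hp hε hφ hφpos hφm hφK hu hupos hadm hsol
  have hgrad : ∀ x : EuclideanSpace ℝ (Fin (N + 2)), ‖x‖ = 1 →
      ‖fderiv ℝ (fun y => Real.log (Sph.ext u y)) x‖ ≤ G := fun x hx =>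
    hlog.norm_fderiv_le hk hkn hx
  constructor
  · intro x
    refine le_trans ?_ (le_max_left _ _)
    rw [Sph.norm_grad_eq hu hupos, mul_div_cancel_left₀ _ (hupos x).ne']
    exact hgrad x (mem_sphere_zero_iff_norm.1 x.2)
  · have : Nonempty (Sph (N + 1)) := (NormedSpace.sphere_nonempty.2 zero_le_one).to_subtype
    refine (Sph.iSup_div_iInf_le hupos (Real.exp_pos (8 * G)) fun x y => ?_).trans (le_max_right _ _)
    have h1 := Sph.abs_sub_le_on_sphere hlog.hom
      (fun y hy => (hlog.contDiffAt y hy).differentiableAt two_ne_zero) hgrad (by linarith)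
      (mem_sphere_zero_iff_norm.1 x.2) (mem_sphere_zero_iff_norm.1 y.2)
    rw [Sph.ext_coe, Sph.ext_coe] at h1
    have h2 := (le_abs_self _).trans h1
    rw [← Real.exp_log (hupos x), ← Real.exp_log (hupos y), ← Real.exp_add]
    exact Real.exp_le_exp.2 (by linarith)
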